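/- There are constants $C,d\in\mathbb N$ such that for every $n\in\mathbb N$ there is an integer program formulation with at most $Cn^3$ integer variables and at most $Cn^3$ constraints that finds the minimum height of a planar straight-line drawing of any $n$-vertex simple graph. Precisely: there are $k,m\le Cn^3$, integer matrices $A\in\mathbb Z^{m\times k}$, $B\in\mathbb Z^{m\times n^2}$ and vectors $b\in\mathbb Z^m$, $c\in\mathbb Z^k$, all of whose entries have absolute value at most $Cn^d$, such that for every simple graph $G$ on the vertex set $\{1,\dots,n\}$, with $0/1$ adjacency vector $a_G\in\{0,1\}^{n^2}$, the integer program $$\min\ c^{\top}z\quad\text{subject to}\quad Az\le b+B\,a_G,\quad z\in\mathbb Z^k,$$ is feasible if and only if $G$ has a planar straight-line drawing, and, for every $h\in\mathbb N$, its optimal value is $h$ if and only if $h$ is the minimum height of a planar straight-line drawing of $G$. Here a planar straight-line drawing of $G$ places the vertices at distinct points of $\mathbb Z^2$ and draws each edge as the straight segment between its ends, such that no vertex lies on an edge of which it is not an end, and two distinct edges meet only at a common end. Its height is the least $h$ such that, after a translation, all vertices lie on a grid $[1,w]\times[1,h]$ for some $w$. -/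

import Mathlib

/-- A planar straight-line drawing of the simple graph `G` on the integer grid: vertices are
pairwise distinct grid points, every edge is the line segment between its ends, and no two
elements of the drawing meet unless the corresponding elements of the graph do. -/
structure PlanarStraightLineDrawing {V : Type*} (G : SimpleGraph V) where
  x : V → ℤ
  y : V → ℤ
  vertex_disjoint : ∀ u v : V, u ≠ v → (x u, y u) ≠ (x v, y v)
  vertex_edge_disjoint : ∀ u v w : V, G.Adj u v → w ≠ u → w ≠ v →
    ((x w : ℝ), (y w : ℝ)) ∉ segment ℝ ((x u : ℝ), (y u : ℝ)) ((x v : ℝ), (y v : ℝ))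
  edge_edge_disjoint : ∀ u v u' v' : V, G.Adj u v → G.Adj u' v' → s(u, v) ≠ s(u', v') →
    ∀ p : ℝ × ℝ,
      p ∈ segment ℝ ((x u : ℝ), (y u : ℝ)) ((x v : ℝ), (y v : ℝ)) →
      p ∈ segment ℝ ((x u' : ℝ), (y u' : ℝ)) ((x v' : ℝ), (y v' : ℝ)) →
      ∃ w : V, (w = u ∨ w = v) ∧ (w = u' ∨ w = v') ∧ p = ((x w : ℝ), (y w : ℝ))

namespace PlanarStraightLineDrawing

variable {V : Type*} {G : SimpleGraph V}

/-- After a translation, all vertices lie on the `[1, w] × [1, h]` grid. -/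
def FitsGrid (D : PlanarStraightLineDrawing G) (w h : ℕ) : Prop :=
  ∃ s t : ℤ, ∀ v : V,
    (1 ≤ D.x v + s ∧ D.x v + s ≤ (w : ℤ)) ∧ (1 ≤ D.y v + t ∧ D.y v + t ≤ (h : ℤ))

/-- The height of a drawing of a finite graph: the number of rows of the smallest grid that
holds it. -/
noncomputable def height (D : PlanarStraightLineDrawing G) : ℕ :=
  sInf {h : ℕ | ∃ w : ℕ, D.FitsGrid w h}

end PlanarStraightLineDrawing

/-- `h` is the minimum height of a planar straight-line drawing of `G`. -/
def IsMinStraightLineHeight {V : Type*} (G : SimpleGraph V) (h : ℕ) : Prop :=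
  IsLeast (Set.range fun D : PlanarStraightLineDrawing G => D.height) h

/-- The integer (linear) program `min c ⬝ z` subject to `A z ≤ b`, `z` integral, with `k`
variables and `m` constraints. -/
structure IntegerProgram (k m : ℕ) where
  A : Matrix (Fin m) (Fin k) ℤ
  b : Fin m → ℤ
  c : Fin k → ℤ

namespace IntegerProgram

variable {k m : ℕ}

def IsFeasible (P : IntegerProgram k m) (z : Fin k → ℤ) : Prop :=
  ∀ j : Fin m, ∑ i : Fin k, P.A j i * z i ≤ P.b j

def objective (P : IntegerProgram k m) (z : Fin k → ℤ) : ℤ :=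
  ∑ i : Fin k, P.c i * z i

/-- `t` is the optimal value of the program (in particular, it is attained). -/
def IsOptimalValue (P : IntegerProgram k m) (t : ℤ) : Prop :=
  IsLeast (P.objective '' {z | P.IsFeasible z}) t

end IntegerProgram

/-- An integer program formulation for graphs on the vertex set `Fin n`: the constraint matrix
and the objective are the same for all graphs, and the graph enters as data, namely through its
0/1 adjacency entries, linearly in the right-hand sides. -/
structure GraphIPFormulation (n k m : ℕ) where
  A : Matrix (Fin m) (Fin k) ℤ
  b : Fin m → ℤ
  B : Fin m → Fin n → Fin n → ℤ
  c : Fin k → ℤ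

namespace GraphIPFormulation

variable {n k m : ℕ}

open Classical in
/-- The integer program that the formulation gives for the graph `G`. -/
noncomputable def program (F : GraphIPFormulation n k m) (G : SimpleGraph (Fin n)) :
    IntegerProgram k m where
  A := F.A
  b := fun j => F.b j + ∑ u : Fin n, ∑ v : Fin n, F.B j u v * (if G.Adj u v then 1 else 0)
  c := F.c

/-- All numbers in the formulation have absolute value at most `M`. -/
def CoeffsBoundedBy (F : GraphIPFormulation n k m) (M : ℤ) : Prop :=
  (∀ j i, |F.A j i| ≤ M) ∧ (∀ j, |F.b j| ≤ M) ∧ (∀ j u v, |F.B j u v| ≤ M) ∧ (∀ i, |F.c i| ≤ M)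

end GraphIPFormulation

/-! The program searches for a `BarRep`: vertices are disjoint horizontal bars in rows, and edges
are vertical visibilities or adjacencies of consecutive bars in a row. Its correctness rests on an
equivalence: a graph has a planar straight-line drawing of height at most `h` exactly when it has a
bar representation in `h` rows.

From drawings to bars (`PlanarStraightLineDrawing.exists_barRep`): "left of at some common height"
extends to a linear order of the vertices and nonhorizontal edges. Ranks in this order serve as
columns, and the bar of a vertex covers its own rank and those of its nonhorizontal edges. Ranks are
at most `n ^ 2`, and rows can be renumbered up to `n`, so implications can be linearised with
polynomial big-M constants.

From bars to drawings (`BarRep.exists_drawing`): rows are kept and only new x-coordinates are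
needed. Sweep the columns from left to right with a front that holds one position per row. A
vertical edge is a chord between two rows of the front; each row strictly between must lie left of
the chord beforehand and be pushed right of it. A careless push can spoil a later chord, so the
overshoots have to be chosen well. `Sweep.exists_front` starts from a convex front with all
overshoots zero, where no crossed row lies right of its chord, and makes the overshoots positive one
at a time. A cell can be activated if its row has slack at its next crossing (`Sweep.Good.extend`).
Such a cell exists as long as one is missing (`Sweep.Good.stuck`), since otherwise a chord would be
repeated between two unmoved ends, which a simple graph excludes.

Bar representations are then encoded by a column and order bits for each pair and avoidance bits for
each triple, hence with cubically many variables and constraints. -/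

/-! ### The moving front: crossed rows never lie right of the chord. -/

/-- Data of a left-to-right sweep: at time `t` a chord spans the rows from `lo t` to `hi t`, and
the rows in `jump t` are shifted. -/
structure Sweep where
  lo : ℕ → ℤ
  hi : ℕ → ℤ
  jump : ℕ → Set ℤ

namespace Sweep

variable (S : Sweep)

/-- The chord at time `t` passes strictly through row `r`. -/
def Cross (t : ℕ) (r : ℤ) : Prop := S.lo t < r ∧ r < S.hi t

/-- Row `r` changes at time `t`. -/
def Touch (t : ℕ) (r : ℤ) : Prop := S.Cross t r ∨ r ∈ S.jump t

/-- The chord at time `t` of the front `f`, evaluated in row `r`. -/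
def chord (f : ℤ → ℚ) (t : ℕ) (r : ℤ) : ℚ :=
  (f (S.lo t) * (S.hi t - r) + f (S.hi t) * (r - S.lo t)) / (S.hi t - S.lo t)

open Classical in
/-- The front at each time, when row `r` overshoots by `α t r` at time `t`. -/
noncomputable def front (α : ℕ → ℤ → ℚ) : ℕ → ℤ → ℚ
  -- Strict convexity puts every chord of the initial front strictly to the right of the rows that
  -- it crosses.
  | 0, r => (r : ℚ) ^ 2
  | t + 1, r =>
    if S.Cross t r then S.chord (front α t) t r + α t r
    else if r ∈ S.jump t then front α t r + α t r else front α t r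

/-- Row `r` has been moved by a cell of `A` since its last crossing before `t`, or has never been
crossed before `t`. -/
def Active (A : Set (ℕ × ℤ)) (t : ℕ) (r : ℤ) : Prop :=
  (∀ s < t, ¬ S.Cross s r) ∨ ∃ s < t, (s, r) ∈ A ∧ ∀ j, s < j → j < t → ¬ S.Cross j r

/-- The invariant of the construction, where a cell is a pair of a time and a row: exactly the cells
of `A` overshoot, and strictness is demanded only at crossings where it can be expected. A row left
exactly on its last chord may be tight at the next one. -/
structure Good (A : Set (ℕ × ℤ)) (α : ℕ → ℤ → ℚ) : Prop where
  pos : ∀ t r, (t, r) ∈ A → 0 < α t r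
  zero : ∀ t r, (t, r) ∉ A → α t r = 0
  strict : ∀ t r, S.Cross t r → S.Active A t r → S.front α t r < S.chord (S.front α t) t r

variable {S}

lemma chord_affine (f : ℤ → ℚ) (t : ℕ) (p q s : ℤ) :
    S.chord f t q * (s - p) = S.chord f t p * (s - q) + S.chord f t s * (q - p) := by
  unfold chord; ring

lemma chord_lo (f : ℤ → ℚ) {t : ℕ} (h : S.lo t < S.hi t) : S.chord f t (S.lo t) = f (S.lo t) := by
  have : (S.hi t : ℚ) - S.lo t ≠ 0 := by
    have : (S.lo t : ℚ) < S.hi t := by exact_mod_cast h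
    linarith
  unfold chord; field_simp; ring

lemma chord_hi (f : ℤ → ℚ) {t : ℕ} (h : S.lo t < S.hi t) : S.chord f t (S.hi t) = f (S.hi t) := by
  have : (S.hi t : ℚ) - S.lo t ≠ 0 := by
    have : (S.lo t : ℚ) < S.hi t := by exact_mod_cast h
    linarith
  unfold chord; field_simp; ring

lemma Cross.lt {t : ℕ} {r : ℤ} (h : S.Cross t r) : S.lo t < S.hi t := h.1.trans h.2

lemma front_cross {α : ℕ → ℤ → ℚ} {t : ℕ} {r : ℤ} (h : S.Cross t r) :
    S.front α (t + 1) r = S.chord (S.front α t) t r + α t r := by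
  rw [front, if_pos h]

lemma front_jump {α : ℕ → ℤ → ℚ} {t : ℕ} {r : ℤ} (h : ¬ S.Cross t r) (h' : r ∈ S.jump t) :
    S.front α (t + 1) r = S.front α t r + α t r := by
  rw [front, if_neg h, if_pos h']

lemma front_still {α : ℕ → ℤ → ℚ} {t : ℕ} {r : ℤ} (h : ¬ S.Touch t r) :
    S.front α (t + 1) r = S.front α t r := by
  rw [front, if_neg (fun h' => h (Or.inl h')), if_neg (fun h' => h (Or.inr h'))]

/-- The hypothesis `h` says that the values at `p`, `q`, `s` are those of an affine function; such a
function cannot have an interior maximum unless it is constant. -/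
lemma affine_lt {dp dq ds : ℚ} {p q s : ℤ} (hp : p < q) (hs : q < s)
    (h : dq * (s - p) = dp * (s - q) + ds * (q - p)) (h1 : dp < dq) (h2 : ds ≤ dq) : False := by
  have hp' : (0 : ℚ) < q - p := by have : (p : ℚ) < q := by exact_mod_cast hp
                                   linarith
  have hs' : (0 : ℚ) < s - q := by have : (q : ℚ) < s := by exact_mod_cast hs
                                   linarith
  nlinarith [mul_lt_mul_of_pos_right h1 hs', mul_le_mul_of_nonneg_right h2 hp'.le]

lemma affine_zero {dp dq ds : ℚ} {p q s : ℤ} (hp : p < q) (hs : q < s)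
    (h : dq * (s - p) = dp * (s - q) + ds * (q - p)) (h0 : dq = 0) (h1 : 0 ≤ dp) (h2 : 0 ≤ ds) :
    dp = 0 ∧ ds = 0 := by
  have hp' : (0 : ℚ) < q - p := by have : (p : ℚ) < q := by exact_mod_cast hp
                                   linarith
  have hs' : (0 : ℚ) < s - q := by have : (q : ℚ) < s := by exact_mod_cast hs
                                   linarith
  rw [h0, zero_mul] at h
  have a1 := mul_nonneg h1 hs'.le
  have a2 := mul_nonneg h2 hp'.le
  constructor
  · have : dp * (s - q) = 0 := by linarith
    rcases mul_eq_zero.1 this with h | h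
    · exact h
    · linarith
  · have : ds * (q - p) = 0 := by linarith
    rcases mul_eq_zero.1 this with h | h
    · exact h
    · linarith

namespace Good

variable {A : Set (ℕ × ℤ)} {α : ℕ → ℤ → ℚ}

lemma nonneg (hG : S.Good A α) (t : ℕ) (r : ℤ) : 0 ≤ α t r := by
  by_cases h : (t, r) ∈ A
  · exact (hG.pos t r h).le
  · exact (hG.zero t r h).ge

lemma step_of_le (hG : S.Good A α) {t : ℕ} {r : ℤ}
    (h : S.Cross t r → S.front α t r ≤ S.chord (S.front α t) t r) :
    S.front α t r ≤ S.front α (t + 1) r := by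
  have := hG.nonneg t r
  by_cases hc : S.Cross t r
  · rw [front_cross hc]; linarith [h hc]
  · by_cases hj : r ∈ S.jump t
    · rw [front_jump hc hj]; linarith
    · rw [front_still (fun h' => h'.elim hc hj)]

lemma const_of_no_cell (hG : S.Good A α) {s t : ℕ} {r : ℤ} (hst : s ≤ t)
    (hc : ∀ j, s ≤ j → j < t → ¬ S.Cross j r) (hA : ∀ j, s ≤ j → j < t → (j, r) ∉ A) :
    S.front α t r = S.front α s r := by
  induction t, hst using Nat.le_induction with
  | base => rfl
  | succ k hk ih =>
    rw [← ih (fun j h1 h2 => hc j h1 (h2.trans k.lt_succ_self))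
      (fun j h1 h2 => hA j h1 (h2.trans k.lt_succ_self))]
    have h1 := hc k hk k.lt_succ_self
    by_cases hj : r ∈ S.jump k
    · rw [front_jump h1 hj, hG.zero _ _ (hA k hk k.lt_succ_self), add_zero]
    · exact front_still (fun h' => h'.elim h1 hj)

end Good

/-- The last crossing of a row before a given time. -/
lemma exists_last_cross {t : ℕ} {r : ℤ} (h : ∃ s < t, S.Cross s r) :
    ∃ s < t, S.Cross s r ∧ ∀ j, s < j → j < t → ¬ S.Cross j r := by
  obtain ⟨s, ⟨h1, h2⟩, h3⟩ := Set.exists_max_image {s | s < t ∧ S.Cross s r} id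
    ((Set.finite_lt_nat t).subset fun s hs => hs.1) (by obtain ⟨s, h⟩ := h; exact ⟨s, h⟩)
  exact ⟨s, h1, h2, fun j hj hjt hc => absurd (h3 j ⟨hjt, hc⟩) (by simpa using hj)⟩

/-- At a first violation, the row that protrudes most is inactive, so it still lies on the chord of
its last crossing. The present front is nowhere left of that old chord on its range. Hence the
affine difference of the old and the present chord would have an interior maximum on their common
range. -/
lemma Good.le_chord {A : Set (ℕ × ℤ)} {α : ℕ → ℤ → ℚ} (hG : S.Good A α) :
    ∀ t r, S.Cross t r → S.front α t r ≤ S.chord (S.front α t) t r := by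
  intro t
  induction t using Nat.strong_induction_on with
  | _ t ih =>
  have mono : ∀ r s k, s ≤ k → k ≤ t → S.front α s r ≤ S.front α k r := by
    intro r s k hsk
    induction k, hsk using Nat.le_induction with
    | base => intro _; exact le_rfl
    | succ k hk ih' =>
      intro hkt
      have := hG.step_of_le (ih k hkt r)
      exact (ih' (by omega)).trans this
  by_contra! hcon
  obtain ⟨r0, hr0, hlt0⟩ := hcon
  have hlh := hr0.lt
  set g : ℤ → ℚ := fun r => S.front α t r - S.chord (S.front α t) t r with hg
  have g_lo : g (S.lo t) = 0 := by simp [hg, chord_lo _ hlh]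
  have g_hi : g (S.hi t) = 0 := by simp [hg, chord_hi _ hlh]
  obtain ⟨r1, hr1, hmax1⟩ := Finset.exists_max_image (Finset.Icc (S.lo t) (S.hi t)) g
    ⟨r0, Finset.mem_Icc.2 ⟨hr0.1.le, hr0.2.le⟩⟩
  -- The lowest of the maximising rows, so that the maximum is strict towards lower rows, as
  -- `affine_lt` requires.
  obtain ⟨r, hr, hmin⟩ := Finset.exists_min_image
    ((Finset.Icc (S.lo t) (S.hi t)).filter fun r => g r = g r1) id ⟨r1, by simp [Finset.mem_Icc.1 hr1]⟩
  simp only [Finset.mem_filter, Finset.mem_Icc, id] at hr hmin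
  have hpos : 0 < g r := by
    have := hmax1 r0 (Finset.mem_Icc.2 ⟨hr0.1.le, hr0.2.le⟩)
    rw [hr.2]
    refine lt_of_lt_of_le ?_ this
    simp only [hg]; linarith
  have hle : ∀ p, S.lo t ≤ p → p ≤ S.hi t → g p ≤ g r := fun p h1 h2 =>
    hr.2 ▸ hmax1 p (Finset.mem_Icc.2 ⟨h1, h2⟩)
  have hltr : ∀ p, S.lo t ≤ p → p < r → g p < g r := fun p h1 h2 =>
    lt_of_le_of_ne (hle p h1 (by omega)) fun h =>
      absurd (hmin p ⟨⟨h1, by omega⟩, h.trans hr.2⟩) (by omega)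
  have hc : S.Cross t r := by
    refine ⟨lt_of_le_of_ne hr.1.1 ?_, lt_of_le_of_ne hr.1.2 ?_⟩
    · intro h; rw [← h, g_lo] at hpos; exact lt_irrefl _ hpos
    · intro h; rw [h, g_hi] at hpos; exact lt_irrefl _ hpos
  have hna : ¬ S.Active A t r := by
    intro h
    have := hG.strict t r hc h
    simp only [hg] at hpos; linarith
  simp only [Active, not_or, not_forall, not_exists, not_and, not_not] at hna
  obtain ⟨⟨s0, hs0, hc0⟩, hno⟩ := hna
  obtain ⟨s, hs, hcs, hlast⟩ := exists_last_cross ⟨s0, hs0, hc0⟩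
  have hnA : ∀ j, s ≤ j → j < t → (j, r) ∉ A := by
    intro j h1 h2 h3
    obtain ⟨k, hk1, hk2, hk3⟩ := hno j h2 h3
    exact hlast k (by omega) hk2 hk3
  -- The row was put exactly on the chord at time `s` and has not moved since.
  have hval : S.front α t r = S.chord (S.front α s) s r := by
    rw [hG.const_of_no_cell (s := s + 1) (t := t) (by omega)
      (fun j h1 h2 => hlast j (by omega) h2) (fun j h1 h2 => hnA j (by omega) h2), front_cross hcs,
      hG.zero _ _ (hnA s le_rfl hs), add_zero]
  have hge : ∀ p, S.lo s ≤ p → p ≤ S.hi s → S.chord (S.front α s) s p ≤ S.front α t p := by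
    intro p h1 h2
    rcases h1.eq_or_lt with h1 | h1
    · rw [← h1, chord_lo _ hcs.lt]; exact mono _ _ _ hs.le le_rfl
    rcases h2.eq_or_lt with h2 | h2
    · rw [h2, chord_hi _ hcs.lt]; exact mono _ _ _ hs.le le_rfl
    · refine le_trans ?_ (mono p (s + 1) t (by omega) le_rfl)
      rw [front_cross ⟨h1, h2⟩]; linarith [hG.nonneg s p]
  have e1 := chord_affine (S := S) (S.front α s) s (max (S.lo s) (S.lo t)) r
    (min (S.hi s) (S.hi t))
  have e2 := chord_affine (S := S) (S.front α t) t (max (S.lo s) (S.lo t)) r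
    (min (S.hi s) (S.hi t))
  have l1 : max (S.lo s) (S.lo t) < r := max_lt hcs.1 hc.1
  have l2 : r < min (S.hi s) (S.hi t) := lt_min hcs.2 hc.2
  have l3 := le_max_left (S.lo s) (S.lo t)
  have l4 := le_max_right (S.lo s) (S.lo t)
  have l5 := min_le_left (S.hi s) (S.hi t)
  have l6 := min_le_right (S.hi s) (S.hi t)
  generalize max (S.lo s) (S.lo t) = p at *
  generalize min (S.hi s) (S.hi t) = q at *
  refine affine_lt (dp := S.chord (S.front α s) s p - S.chord (S.front α t) t p)
    (dq := S.chord (S.front α s) s r - S.chord (S.front α t) t r)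
    (ds := S.chord (S.front α s) s q - S.chord (S.front α t) t q) l1 l2 (by linarith) ?_ ?_
  · have h1 := hge p l3 (by omega)
    have h2 := hltr p l4 l1
    simp only [hg] at h2; linarith
  · have h1 := hge q (by omega) l5
    have h2 := hle q (by omega) l6
    simp only [hg] at h2; linarith

namespace Good

variable {A : Set (ℕ × ℤ)} {α : ℕ → ℤ → ℚ}

lemma add_le_succ (hG : S.Good A α) {t : ℕ} {r : ℤ} (h : S.Touch t r) :
    S.front α t r + α t r ≤ S.front α (t + 1) r := by
  by_cases hc : S.Cross t r
  · rw [front_cross hc]; linarith [hG.le_chord t r hc]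
  · rw [front_jump hc (h.resolve_left hc)]

lemma le_succ (hG : S.Good A α) (t : ℕ) (r : ℤ) :
    S.front α t r ≤ S.front α (t + 1) r := by
  by_cases h : S.Touch t r
  · linarith [hG.add_le_succ h, hG.nonneg t r]
  · rw [front_still h]

lemma mono (hG : S.Good A α) (r : ℤ) : Monotone fun t => S.front α t r :=
  monotone_nat_of_le_succ fun t => hG.le_succ t r

lemma chord_le (hG : S.Good A α) {i t : ℕ} (hit : i < t) {p : ℤ} (h1 : S.lo i ≤ p)
    (h2 : p ≤ S.hi i) (hlt : S.lo i < S.hi i) :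
    S.chord (S.front α i) i p ≤ S.front α t p := by
  rcases h1.eq_or_lt with h1 | h1
  · rw [← h1, chord_lo _ hlt]; exact hG.mono _ hit.le
  rcases h2.eq_or_lt with h2 | h2
  · rw [h2, chord_hi _ hlt]; exact hG.mono _ hit.le
  · refine le_trans ?_ (hG.mono p hit)
    show _ ≤ S.front α (i + 1) p
    rw [front_cross ⟨h1, h2⟩]; linarith [hG.nonneg i p]

lemma le_chord' (hG : S.Good A α) {t : ℕ} {p : ℤ} (h1 : S.lo t ≤ p)
    (h2 : p ≤ S.hi t) (hlt : S.lo t < S.hi t) :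
    S.front α t p ≤ S.chord (S.front α t) t p := by
  rcases h1.eq_or_lt with h1 | h1
  · rw [← h1, chord_lo _ hlt]
  rcases h2.eq_or_lt with h2 | h2
  · rw [h2, chord_hi _ hlt]
  · exact hG.le_chord t p ⟨h1, h2⟩

end Good

end Sweep

/-! ### Activating all overshoots one by one. -/

namespace Sweep

variable {S : Sweep} {A : Set (ℕ × ℤ)} {α : ℕ → ℤ → ℚ}

/-- The front depends affinely on the overshoots, so every slack is affine in `ε`, and a small `ε >
0` preserves finitely many strict inequalities. -/
lemma front_add_smul (α δ : ℕ → ℤ → ℚ) (ε : ℚ) (t : ℕ) (r : ℤ) :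
    S.front (fun s p => α s p + ε * δ s p) t r =
      S.front α t r + ε * (S.front (fun s p => α s p + δ s p) t r - S.front α t r) := by
  induction t generalizing r with
  | zero => simp [front]
  | succ t ih =>
    by_cases hc : S.Cross t r
    · rw [front_cross hc, front_cross hc, front_cross hc]
      unfold chord
      rw [ih, ih]
      ring
    · by_cases hj : r ∈ S.jump t
      · rw [front_jump hc hj, front_jump hc hj, front_jump hc hj, ih]; ring
      · have : ¬ S.Touch t r := fun h => h.elim hc hj
        rw [front_still this, front_still this, front_still this, ih]

lemma exists_small {ι : Type*} (s : Set ι) (hs : s.Finite) (D E : ι → ℚ) (hD : ∀ c ∈ s, 0 < D c) :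
    ∃ ε : ℚ, 0 < ε ∧ ∀ c ∈ s, 0 < D c + ε * E c := by
  induction s, hs using Set.Finite.induction_on with
  | empty => exact ⟨1, one_pos, by simp⟩
  | @insert a s _ _ ih =>
    obtain ⟨ε, h0, h⟩ := ih fun c hc => hD c (Or.inr hc)
    have ha := hD a (Or.inl rfl)
    have hE : 0 < 1 + |E a| := by positivity
    refine ⟨min ε (D a / (1 + |E a|)), lt_min h0 (div_pos ha hE), ?_⟩
    have hm1 := min_le_left ε (D a / (1 + |E a|))
    have hm2 := min_le_right ε (D a / (1 + |E a|))
    have hm0 : 0 < min ε (D a / (1 + |E a|)) := lt_min h0 (div_pos ha hE)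
    generalize min ε (D a / (1 + |E a|)) = m at *
    rintro c (rfl | hc)
    · rw [le_div_iff₀ hE] at hm2
      nlinarith [neg_abs_le (E c)]
    · have h1 := h c hc
      have h2 := hD c (Or.inr hc)
      rcases le_or_gt 0 (E c) with h3 | h3
      · positivity
      · nlinarith

lemma chord_sub_eq (f g : ℤ → ℚ) (ε : ℚ) (t : ℕ) (r : ℤ) :
    S.chord (fun p => f p + ε * (g p - f p)) t r =
      S.chord f t r + ε * (S.chord g t r - S.chord f t r) := by
  unfold chord; ring

/-- A cell whose row stays strictly left of its next chord can be activated. -/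
lemma Good.extend (hfin : {c : ℕ × ℤ | S.Touch c.1 c.2}.Finite) (hG : S.Good A α) {i : ℕ} {r : ℤ}
    (hnext : ∀ t, i < t → S.Cross t r → (∀ j, i < j → j < t → ¬ S.Cross j r) →
      S.front α t r < S.chord (S.front α t) t r) (hni : (i, r) ∉ A) :
    ∃ β, S.Good (insert (i, r) A) β := by
  classical
  set δ : ℕ → ℤ → ℚ := fun s p => if (s, p) = (i, r) then 1 else 0 with hδ
  set Y : ℕ → ℤ → ℚ := S.front (fun s p => α s p + δ s p) with hY
  obtain ⟨ε, hε, hlt⟩ := exists_small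
    {c : ℕ × ℤ | S.Cross c.1 c.2 ∧ S.Active (insert (i, r) A) c.1 c.2}
    (hfin.subset fun c hc => Or.inl hc.1)
    (fun c => S.chord (S.front α c.1) c.1 c.2 - S.front α c.1 c.2)
    (fun c => (S.chord (Y c.1) c.1 c.2 - S.chord (S.front α c.1) c.1 c.2) -
      (Y c.1 c.2 - S.front α c.1 c.2)) (by
      rintro ⟨t, p⟩ ⟨hc, ha⟩
      simp only at hc ha ⊢
      rw [sub_pos]
      rcases ha with ha | ⟨s, hs, hsA, hsl⟩
      · exact hG.strict t p hc (Or.inl ha)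
      -- The only crossing that can become newly active is the next crossing of row `r` after time
      -- `i`, where slack is assumed.
      · rcases hsA with h | h
        · obtain ⟨rfl, rfl⟩ := Prod.mk.inj h
          exact hnext t hs hc hsl
        · exact hG.strict t p hc (Or.inr ⟨s, hs, h, hsl⟩))
  refine ⟨fun s p => α s p + ε * δ s p, ?_, ?_, ?_⟩
  · rintro t p (h | h)
    · have h1 := hG.nonneg t p
      simp only [hδ, h, if_true]; linarith
    · have h1 := hG.pos t p h
      have h2 : 0 ≤ δ t p := by simp only [hδ]; split_ifs <;> norm_num
      have := mul_nonneg hε.le h2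
      linarith
  · intro t p h
    simp only [Set.mem_insert_iff, not_or] at h
    simp only [hδ, if_neg h.1, hG.zero t p h.2, mul_zero, add_zero]
  · intro t p hc ha
    have h := hlt (t, p) ⟨hc, ha⟩
    have e : S.front (fun s p => α s p + ε * δ s p) t =
        fun p => S.front α t p + ε * (Y t p - S.front α t p) := by
      ext p; exact front_add_smul α δ ε t p
    rw [e, chord_sub_eq]
    simp only at h ⊢
    linarith

lemma sq_lt_chord {f : ℤ → ℚ} (hf : ∀ p : ℤ, (p : ℚ) ^ 2 ≤ f p) {t : ℕ} {r : ℤ}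
    (h : S.Cross t r) : (r : ℚ) ^ 2 < S.chord f t r := by
  have h1 : (S.lo t : ℚ) < r := by exact_mod_cast h.1
  have h2 : (r : ℚ) < S.hi t := by exact_mod_cast h.2
  unfold chord
  rw [lt_div_iff₀ (by linarith)]
  have h3 := mul_le_mul_of_nonneg_right (hf (S.lo t)) (sub_nonneg.2 h2.le)
  have h4 := mul_le_mul_of_nonneg_right (hf (S.hi t)) (sub_nonneg.2 h1.le)
  have h5 := mul_pos (mul_pos (sub_pos.2 h1) (sub_pos.2 h2)) (sub_pos.2 (h1.trans h2))
  nlinarith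

lemma sq_le_front_zero (t : ℕ) (r : ℤ) : (r : ℚ) ^ 2 ≤ S.front 0 t r := by
  induction t generalizing r with
  | zero => exact le_rfl
  | succ t ih =>
    by_cases hc : S.Cross t r
    · rw [front_cross hc, Pi.zero_apply, Pi.zero_apply, add_zero]
      exact (sq_lt_chord ih hc).le
    · by_cases hj : r ∈ S.jump t
      · rw [front_jump hc hj, Pi.zero_apply, Pi.zero_apply, add_zero]; exact ih r
      · rw [front_still (fun h => h.elim hc hj)]; exact ih r

lemma front_zero_of_no_cross {t : ℕ} {r : ℤ} (h : ∀ s < t, ¬ S.Cross s r) :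
    S.front 0 t r = (r : ℚ) ^ 2 := by
  induction t with
  | zero => rfl
  | succ t ih =>
    rw [← ih fun s hs => h s (hs.trans t.lt_succ_self)]
    by_cases hj : r ∈ S.jump t
    · rw [front_jump (h t t.lt_succ_self) hj, Pi.zero_apply, Pi.zero_apply, add_zero]
    · exact front_still fun h' => h'.elim (h t t.lt_succ_self) hj

/-- With nothing activated, the active rows are those never crossed. They stay on the parabola,
while the front, and with it every chord, stays on or right of it. -/
lemma good_empty : S.Good ∅ 0 := by
  refine ⟨fun t r h => absurd h (Set.notMem_empty _), fun _ _ _ => rfl, fun t r hc ha => ?_⟩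
  have ha : ∀ s < t, ¬ S.Cross s r :=
    ha.resolve_right fun ⟨s, _, h, _⟩ => absurd h (Set.notMem_empty _)
  rw [front_zero_of_no_cross ha]
  exact sq_lt_chord (fun p => sq_le_front_zero t p) hc

/-- Here `i` bounds the missing cells from below: a row not crossed from time `i` on was last
crossed at a cell of `A`, if it was crossed at all. -/
lemma exists_active_of_minimal {i : ℕ} (hmin : ∀ s p, S.Touch s p → (s, p) ∉ A → i ≤ s) {ρ : ℤ}
    {t : ℕ} (h : ∀ j, i ≤ j → j < t → ¬ S.Cross j ρ) : S.Active A t ρ := by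
  by_cases hex : ∃ s < t, S.Cross s ρ
  · obtain ⟨s, hs, hcs, hl⟩ := exists_last_cross hex
    have hsi : s < i := by
      by_contra hsi
      exact h s (by omega) hs hcs
    refine Or.inr ⟨s, hs, ?_, hl⟩
    by_contra hA
    exact absurd (hmin s ρ (Or.inl hcs) hA) (by omega)
  · push Not at hex
    exact Or.inl hex

/-- Otherwise all missing cells are tight at their next crossings. Let `i` be the earliest time of a
missing cell and `K` the last time at which a row still lying on the chord of `i` is crossed. The
front at `K` is squeezed between the two chords, which touch in that row and therefore coincide on
their common range. Maximality of `K` and strictness for active rows force equal ends, and these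
ends have not moved, contrary to `hS`. -/
lemma Good.stuck (hfin : {c : ℕ × ℤ | S.Touch c.1 c.2}.Finite)
    (hS : ∀ i k, i < k → S.lo i = S.lo k → S.hi i = S.hi k → (∃ r, S.Cross i r) →
      ∃ j, i ≤ j ∧ j < k ∧ (S.Touch j (S.lo i) ∨ S.Touch j (S.hi i)))
    (hG : S.Good A α) (hA : ∃ t r, S.Touch t r ∧ (t, r) ∉ A) :
    ∃ i r, S.Touch i r ∧ (i, r) ∉ A ∧
      ∀ t, i < t → S.Cross t r → (∀ j, i < j → j < t → ¬ S.Cross j r) →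
        S.front α t r < S.chord (S.front α t) t r := by
  by_contra! hstuck
  -- every remaining cell is tight at its next crossing
  have tight : ∀ s p, S.Touch s p → (s, p) ∉ A → ∃ t, s < t ∧ S.Cross t p ∧
      (∀ j, s < j → j < t → ¬ S.Cross j p) ∧ S.front α t p = S.chord (S.front α t) t p ∧
      ∀ j, s ≤ j → j < t → (j, p) ∉ A := by
    intro s p h1 h2
    obtain ⟨t, h3, h4, h5, h6⟩ := hstuck s p h1 h2
    refine ⟨t, h3, h4, h5, le_antisymm (hG.le_chord t p h4) h6, fun j hj hjt hjA => ?_⟩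
    exact absurd (hG.strict t p h4 (Or.inr ⟨j, hjt, hjA, fun j' h7 h8 => h5 j' (by omega) h8⟩))
      h6.not_gt
  classical
  obtain ⟨i, ⟨r0, hr0, hr0A⟩, hmin⟩ := Nat.findX hA
  replace hmin : ∀ s p, S.Touch s p → (s, p) ∉ A → i ≤ s := fun s p h1 h2 => by
    by_contra h
    exact hmin s (by omega) ⟨p, h1, h2⟩
  -- A row that ends up in place was never touched: a crossing would be strict as the row is active,
  -- and a jump without overshoot would be a missing cell, hence tight at a next crossing where the
  -- row is active.
  have still : ∀ ρ k, i ≤ k → ¬ S.Cross i ρ → S.front α k ρ = S.front α i ρ →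
      ∀ j, i ≤ j → j < k → ¬ S.Touch j ρ := by
    intro ρ k hik hi hk j
    induction j using Nat.strong_induction_on with
    | _ j ih =>
    intro hij hjk ht
    have hno : ∀ j', i ≤ j' → j' < j → ¬ S.Cross j' ρ := fun j' h1 h2 h3 =>
      ih j' h2 h1 (h2.trans hjk) (Or.inl h3)
    have hm1 : S.front α i ρ ≤ S.front α j ρ := hG.mono ρ hij
    have hm2 : S.front α (j + 1) ρ ≤ S.front α k ρ := hG.mono ρ (show j + 1 ≤ k from hjk)
    by_cases hc : S.Cross j ρ
    · have := hG.strict j ρ hc (exists_active_of_minimal hmin hno)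
      rw [front_cross hc] at hm2
      linarith [hG.nonneg j ρ]
    · have hα : α j ρ = 0 := by
        have := hG.add_le_succ ht
        linarith [hG.nonneg j ρ]
      have hjA : (j, ρ) ∉ A := fun h => absurd (hG.pos j ρ h) (by simp [hα])
      obtain ⟨t, h1, h2, h3, h4, -⟩ := tight j ρ ht hjA
      have := hG.strict t ρ h2 (exists_active_of_minimal hmin fun j' h5 h6 => by
        rcases lt_trichotomy j' j with h7 | h7 | h7
        · exact hno j' h5 h7
        · exact h7 ▸ hc
        · exact h3 j' h7 h6)
      exact this.ne h4
  -- If the missing cell were only a jump, its row would be active at its next crossing and could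
  -- not be tight there.
  have hi0 : S.Cross i r0 := by
    by_contra hc
    obtain ⟨t, h1, h2, h3, h4, -⟩ := tight i r0 hr0 hr0A
    have := hG.strict t r0 h2 (exists_active_of_minimal hmin fun j' h5 h6 => by
      rcases h5.eq_or_lt with h7 | h7
      · exact h7 ▸ hc
      · exact h3 j' h7 h6)
    exact this.ne h4
  -- A row still on the chord of `i` has had no positive overshoot at its latest touch, so that cell
  -- is missing and tight.
  have next : ∀ ρ k, i < k → S.Cross i ρ → S.front α k ρ = S.chord (S.front α i) i ρ →
      ∃ t, k ≤ t ∧ S.Cross t ρ ∧ (∀ j, k ≤ j → j < t → ¬ S.Cross j ρ) ∧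
        S.front α t ρ = S.chord (S.front α t) t ρ ∧ S.front α t ρ = S.front α k ρ := by
    intro ρ k hik hi hk
    obtain ⟨s, ⟨⟨his, hsk⟩, hst⟩, hmax⟩ := Set.exists_max_image
      {s | (i ≤ s ∧ s < k) ∧ S.Touch s ρ} id
      ((Set.finite_lt_nat k).subset fun s hs => hs.1.2) ⟨i, ⟨le_rfl, hik⟩, Or.inl hi⟩
    have hl : ∀ j, s < j → j < k → ¬ S.Touch j ρ := fun j h1 h2 h3 =>
      absurd (hmax j ⟨⟨by omega, h2⟩, h3⟩) (by simpa using h1)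
    have hα : α s ρ = 0 := by
      have hm : S.front α (s + 1) ρ ≤ S.front α k ρ := hG.mono ρ (show s + 1 ≤ k from hsk)
      have h0 := hG.nonneg s ρ
      rcases his.eq_or_lt with h | h
      · subst h
        rw [front_cross hi] at hm
        linarith
      · have h1 := hG.chord_le h hi.1.le hi.2.le hi.lt
        have h2 := hG.add_le_succ hst
        linarith
    have hsA : (s, ρ) ∉ A := fun h => absurd (hG.pos s ρ h) (by simp [hα])
    obtain ⟨t, h1, h2, h3, h4, h5⟩ := tight s ρ hst hsA
    have hkt : k ≤ t := by
      by_contra h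
      exact hl t h1 (by omega) (Or.inl h2)
    exact ⟨t, hkt, h2, fun j h6 h7 => h3 j (by omega) h7, h4,
      hG.const_of_no_cell hkt (fun j h6 h7 => h3 j (by omega) h7) fun j h6 h7 =>
        h5 j (by omega) h7⟩
  -- `K` is the last time at which a row crossed at time `i` is crossed while still on the chord of
  -- `i`.
  obtain ⟨K, ⟨hiK, ρ, hKρ, hiρ, hKv⟩, hmax⟩ := Set.exists_max_image
    {t | i < t ∧ ∃ ρ, S.Cross t ρ ∧ S.Cross i ρ ∧ S.front α t ρ = S.chord (S.front α i) i ρ} id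
    ((hfin.image Prod.fst).subset fun t ⟨_, ρ, h, _⟩ => ⟨(t, ρ), Or.inl h, rfl⟩) (by
      have h0 : S.front α (i + 1) r0 = S.chord (S.front α i) i r0 := by
        rw [front_cross hi0, hG.zero _ _ hr0A, add_zero]
      obtain ⟨t, h1, h2, -, -, h3⟩ := next r0 (i + 1) (by omega) hi0 h0
      exact ⟨t, by omega, r0, h2, hi0, h3.trans h0⟩)
  have hKe : S.front α K ρ = S.chord (S.front α K) K ρ := by
    obtain ⟨t, h1, -, h2, h3, -⟩ := next ρ K hiK hiρ hKv
    rcases h1.eq_or_lt with h | h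
    · rw [h]; exact h3
    · exact absurd hKρ (h2 K le_rfl h)
  -- the two chords agree on their common range
  have agree : ∀ p q, S.lo i ≤ p → S.lo K ≤ p → p < ρ → ρ < q → q ≤ S.hi i → q ≤ S.hi K →
      (S.front α K p = S.chord (S.front α i) i p ∧ S.front α K p = S.chord (S.front α K) K p) ∧
      (S.front α K q = S.chord (S.front α i) i q ∧ S.front α K q = S.chord (S.front α K) K q) := by
    intro p q h1 h2 h3 h4 h5 h6
    have e1 := chord_affine (S := S) (S.front α i) i p ρ q
    have e2 := chord_affine (S := S) (S.front α K) K p ρ q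
    have l1 := hG.chord_le hiK h1 (by omega) hiρ.lt
    have l2 := hG.chord_le hiK (p := q) (by omega) h5 hiρ.lt
    have l3 := hG.le_chord' h2 (by omega) hKρ.lt
    have l4 := hG.le_chord' (p := q) (by omega) h6 hKρ.lt
    obtain ⟨z1, z2⟩ := affine_zero
      (dp := S.chord (S.front α K) K p - S.chord (S.front α i) i p)
      (dq := S.chord (S.front α K) K ρ - S.chord (S.front α i) i ρ)
      (ds := S.chord (S.front α K) K q - S.chord (S.front α i) i q) h3 h4 (by linarith)
      (by linarith) (by linarith) (by linarith)
    exact ⟨⟨by linarith, by linarith⟩, by linarith, by linarith⟩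
  obtain ⟨⟨p1, p2⟩, q1, q2⟩ := agree (max (S.lo i) (S.lo K)) (min (S.hi i) (S.hi K))
    (le_max_left _ _) (le_max_right _ _) (max_lt hiρ.1 hKρ.1) (lt_min hiρ.2 hKρ.2)
    (min_le_left _ _) (min_le_right _ _)
  -- a boundary row inside the other chord is impossible
  have inner : ∀ p, S.Cross i p → ¬ S.Cross K p →
      S.front α K p = S.chord (S.front α i) i p → False := by
    intro p h1 h2 h3
    obtain ⟨t, h4, h5, -, -, h6⟩ := next p K hiK h1 h3
    have hne : K ≠ t := fun h => h2 (h ▸ h5)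
    exact absurd (hmax t ⟨by omega, p, h5, h1, h6.trans h3⟩) (by simp only [id]; omega)
  have outer : ∀ p, ¬ S.Cross i p → S.Cross K p → S.front α K p = S.front α i p →
      S.front α K p = S.chord (S.front α K) K p → False := by
    intro p h1 h2 h3 h4
    exact (hG.strict K p h2 (exists_active_of_minimal hmin fun j h5 h6 h7 =>
      still p K hiK.le h1 h3 j h5 h6 (Or.inl h7))).ne h4
  have nlo : ∀ t, ¬ S.Cross t (S.lo t) := fun t h => lt_irrefl _ h.1
  have nhi : ∀ t, ¬ S.Cross t (S.hi t) := fun t h => lt_irrefl _ h.2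
  have hlo : S.lo i = S.lo K := by
    rcases lt_trichotomy (S.lo i) (S.lo K) with h | h | h
    · rw [max_eq_right h.le] at p1
      exact (inner _ ⟨h, hKρ.1.trans hiρ.2⟩ (nlo K) p1).elim
    · exact h
    · rw [max_eq_left h.le] at p1 p2
      rw [chord_lo _ hiρ.lt] at p1
      exact (outer _ (nlo i) ⟨h, hiρ.1.trans hKρ.2⟩ p1 p2).elim
  have hhi : S.hi i = S.hi K := by
    rcases lt_trichotomy (S.hi i) (S.hi K) with h | h | h
    · rw [min_eq_left h.le] at q1 q2
      rw [chord_hi _ hiρ.lt] at q1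
      exact (outer _ (nhi i) ⟨hKρ.1.trans hiρ.2, h⟩ q1 q2).elim
    · exact h
    · rw [min_eq_right h.le] at q1
      exact (inner _ ⟨hiρ.1.trans hKρ.2, h⟩ (nhi K) q1).elim
  rw [← hlo, max_self, chord_lo _ hiρ.lt] at p1
  rw [← hhi, min_self, chord_hi _ hiρ.lt] at q1
  obtain ⟨j, h1, h2, h3⟩ := hS i K hiK hlo hhi ⟨ρ, hiρ⟩
  rcases h3 with h3 | h3
  · exact still _ K hiK.le (nlo i) p1 j h1 h2 h3
  · exact still _ K hiK.le (nhi i) q1 j h1 h2 h3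

/-- A finite sweep in which no chord is repeated while both its ends stay in place can be realised
by a moving front: every crossed row lies strictly left of the chord before the crossing and
strictly right of it afterwards. -/
theorem exists_front (hfin : {c : ℕ × ℤ | S.Touch c.1 c.2}.Finite)
    (hS : ∀ i k, i < k → S.lo i = S.lo k → S.hi i = S.hi k → (∃ r, S.Cross i r) →
      ∃ j, i ≤ j ∧ j < k ∧ (S.Touch j (S.lo i) ∨ S.Touch j (S.hi i))) :
    ∃ X : ℕ → ℤ → ℚ,
      (∀ t r, ¬ S.Touch t r → X (t + 1) r = X t r) ∧
      (∀ t r, S.Touch t r → X t r < X (t + 1) r) ∧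
      ∀ t r, S.Cross t r → X t r < S.chord (X t) t r ∧ S.chord (X t) t r < X (t + 1) r := by
  have key : ∀ n ≤ hfin.toFinset.card, ∃ A ⊆ hfin.toFinset, A.card = n ∧
      ∃ α, S.Good (A : Set (ℕ × ℤ)) α := by
    classical
    intro n
    induction n with
    | zero => exact fun _ => ⟨∅, by simp, rfl, 0, by simpa using good_empty⟩
    | succ n ih =>
      intro hn
      obtain ⟨A, hsub, hcard, α, hG⟩ := ih (by omega)
      obtain ⟨⟨t, r⟩, hc, hcA⟩ := Finset.exists_mem_notMem_of_card_lt_card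
        (show A.card < hfin.toFinset.card by omega)
      obtain ⟨i, p, h1, h2, h3⟩ := hG.stuck hfin hS
        ⟨t, r, by simpa using hc, by simpa using hcA⟩
      obtain ⟨β, hβ⟩ := hG.extend hfin h3 h2
      refine ⟨insert (i, p) A, Finset.insert_subset (by simpa using h1) hsub, ?_, β, by
        simpa using hβ⟩
      rw [Finset.card_insert_of_notMem (by simpa using h2), hcard]
  obtain ⟨A, hsub, hcard, α, hG⟩ := key _ le_rfl
  have hA := Finset.eq_of_subset_of_card_le hsub hcard.ge
  have mem : ∀ t r, S.Touch t r → (t, r) ∈ (A : Set (ℕ × ℤ)) := by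
    intro t r h
    rw [hA]; simpa using h
  refine ⟨S.front α, fun t r h => front_still h, fun t r h => ?_, fun t r h => ⟨?_, ?_⟩⟩
  · linarith [hG.add_le_succ h, hG.pos t r (mem t r h)]
  · refine hG.strict t r h ?_
    by_cases hex : ∃ s < t, S.Cross s r
    · obtain ⟨s, h1, h2, h3⟩ := exists_last_cross hex
      exact Or.inr ⟨s, h1, mem s r (Or.inl h2), h3⟩
    · push Not at hex
      exact Or.inl hex
  · rw [front_cross h]
    linarith [hG.pos t r (mem t r (Or.inl h))]

end Sweep

/-! ### Bar representations and the coordinates obtained by sweeping them. -/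

/-- A bar representation of `G`: vertices are disjoint horizontal bars; an edge is a vertical
segment that joins its two bars and avoids all others, or a horizontal adjacency of bars. -/
structure BarRep {V : Type*} (G : SimpleGraph V) where
  y : V → ℤ
  l : V → ℤ
  r : V → ℤ
  col : V → V → ℤ
  le : ∀ v, l v ≤ r v
  disjoint : ∀ u v, u ≠ v → y u < y v ∨ y v < y u ∨ r u < l v ∨ r v < l u
  edge : ∀ u v, G.Adj u v →
    (y u < y v ∧ (l u ≤ col u v ∧ col u v ≤ r u) ∧ (l v ≤ col u v ∧ col u v ≤ r v) ∧
      ∀ w, y w ≤ y u ∨ y v ≤ y w ∨ r w < col u v ∨ col u v < l w) ∨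
    (y v < y u ∧ (l v ≤ col v u ∧ col v u ≤ r v) ∧ (l u ≤ col v u ∧ col v u ≤ r u) ∧
      ∀ w, y w ≤ y v ∨ y u ≤ y w ∨ r w < col v u ∨ col v u < l w) ∨
    (y u = y v ∧ l v = r u + 1) ∨ (y v = y u ∧ l u = r v + 1)

namespace BarRep

variable {V : Type*} {G : SimpleGraph V} (B : BarRep G)

/-- The bars of `u` and `v` see each other vertically in the column `col u v`. -/
def Up (u v : V) : Prop :=
  B.y u < B.y v ∧ (B.l u ≤ B.col u v ∧ B.col u v ≤ B.r u) ∧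
    (B.l v ≤ B.col u v ∧ B.col u v ≤ B.r v) ∧
    ∀ w, B.y w ≤ B.y u ∨ B.y v ≤ B.y w ∨ B.r w < B.col u v ∨ B.col u v < B.l w

/-- The bar of `v` is the immediate right neighbour of the bar of `u`. -/
def Flat (u v : V) : Prop := B.y u = B.y v ∧ B.l v = B.r u + 1

lemma edge' {u v : V} (h : G.Adj u v) : B.Up u v ∨ B.Up v u ∨ B.Flat u v ∨ B.Flat v u :=
  B.edge u v h

/-- All vertical edges have their own columns, which are nonnegative. -/
structure IsNormal : Prop where
  nonneg : ∀ v, 0 ≤ B.l v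
  inj : ∀ u v u' v', B.col u v = B.col u' v' → u = u' ∧ v = v'

/-- Each column is widened to a block of `K` columns, one for every ordered pair of vertices; a bar
covers whole blocks, so visibilities survive. -/
lemma exists_isNormal [Finite V] : ∃ B' : BarRep G, B'.y = B.y ∧ B'.IsNormal := by
  classical
  have := Fintype.ofFinite V
  obtain ⟨M, hM⟩ := (Set.finite_range fun v => - B.l v).bddAbove
  replace hM : ∀ v, 0 ≤ B.l v + M := fun v => by
    have : -B.l v ≤ M := hM ⟨v, rfl⟩
    linarith
  let e := Fintype.equivFin (V × V)
  obtain ⟨K, hK⟩ : ∃ K : ℤ, K = Fintype.card (V × V) := ⟨_, rfl⟩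
  set ι : V → V → ℤ := fun u v => (e (u, v) : ℕ) with hι
  have hι0 : ∀ u v, 0 ≤ ι u v := fun u v => by simp [hι]
  have hιK : ∀ u v, ι u v + 1 ≤ K := fun u v => by
    have := (e (u, v)).2
    simp only [hι, hK]; omega
  have scale : ∀ a b : ℤ, ∀ u v : V, a ≤ b → K * a ≤ K * b := fun a b u v h =>
    mul_le_mul_of_nonneg_left h (by linarith [hιK u v, hι0 u v])
  have hle : ∀ {a b : ℤ} {u v : V}, a ≤ b →
      K * (a + M) ≤ K * (b + M) + ι u v ∧ K * (a + M) + ι u v ≤ K * (b + M) + K - 1 ∧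
      K * (a + M) ≤ K * (b + M) + K - 1 := fun {a b u v} h => by
    have h1 := scale (a + M) (b + M) u v (by linarith)
    have h2 := hι0 u v
    have h3 := hιK u v
    refine ⟨?_, ?_, ?_⟩ <;> linarith
  have hlt : ∀ {a b : ℤ} {u v : V}, a < b →
      K * (a + M) + K - 1 < K * (b + M) + ι u v ∧ K * (a + M) + ι u v < K * (b + M) ∧
      K * (a + M) + K - 1 < K * (b + M) := fun {a b u v} h => by
    have h1 := scale (a + 1 + M) (b + M) u v (by linarith)
    have h2 := hι0 u v
    have h3 := hιK u v
    refine ⟨?_, ?_, ?_⟩ <;> linarith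
  have up : ∀ u v, B.Up u v → (B.y u < B.y v ∧
      (K * (B.l u + M) ≤ K * (B.col u v + M) + ι u v ∧
        K * (B.col u v + M) + ι u v ≤ K * (B.r u + M) + K - 1) ∧
      (K * (B.l v + M) ≤ K * (B.col u v + M) + ι u v ∧
        K * (B.col u v + M) + ι u v ≤ K * (B.r v + M) + K - 1) ∧
      ∀ w, B.y w ≤ B.y u ∨ B.y v ≤ B.y w ∨
        K * (B.r w + M) + K - 1 < K * (B.col u v + M) + ι u v ∨
        K * (B.col u v + M) + ι u v < K * (B.l w + M)) := by
    rintro u v ⟨h0, ⟨h1, h2⟩, ⟨h3, h4⟩, h5⟩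
    exact ⟨h0, ⟨(hle h1).1, (hle h2).2.1⟩, ⟨(hle h3).1, (hle h4).2.1⟩, fun w =>
      (h5 w).imp id (Or.imp id (Or.imp (fun h => (hlt h).1) fun h => (hlt h).2.1))⟩
  have flat : ∀ u v, B.Flat u v →
      B.y u = B.y v ∧ K * (B.l v + M) = K * (B.r u + M) + K - 1 + 1 := by
    rintro u v ⟨h1, h2⟩
    exact ⟨h1, by rw [h2]; ring⟩
  refine ⟨⟨B.y, fun v => K * (B.l v + M), fun v => K * (B.r v + M) + K - 1,
    fun u v => K * (B.col u v + M) + ι u v, fun v => (hle (u := v) (v := v) (B.le v)).2.2,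
    fun u v huv => ?_, fun u v h => ?_⟩, rfl, ⟨fun v => ?_, fun u v u' v' h => ?_⟩⟩
  · exact (B.disjoint u v huv).imp id (Or.imp id (Or.imp (fun h => (hlt (u := u) (v := v) h).2.2)
      fun h => (hlt (u := u) (v := v) h).2.2))
  · exact (B.edge' h).imp (up u v) (Or.imp (up v u) (Or.imp (flat u v) (flat v u)))
  · exact mul_nonneg (by linarith [hιK v v, hι0 v v]) (hM v)
  · simp only at h
    have h1 := hι0 u v
    have h2 := hιK u v
    have h3 := hι0 u' v'
    have h4 := hιK u' v'
    have hc : B.col u v = B.col u' v' := by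
      rcases lt_trichotomy (B.col u v) (B.col u' v') with h' | h' | h'
      · have := (hlt (u := u) (v := v) h').2.1; linarith
      · exact h'
      · have := (hlt (u := u') (v := v') h').2.1; linarith
    rw [hc] at h
    have : ι u v = ι u' v' := by linarith
    have : (u, v) = (u', v') := e.injective (Fin.ext (by simpa [hι] using this))
    exact Prod.mk.inj this

/-- The edge `p` occupies time `t` of the sweep. -/
def EdgeAt (t : ℕ) (p : V × V) : Prop := B.Up p.1 p.2 ∧ (t : ℤ) = 2 * B.col p.1 p.2 + 1

open Classical in
/-- The sweep of a bar representation from left to right. -/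
noncomputable def sweep : Sweep where
  -- Edges act at odd times and bar starts at even times, so a bar that starts in the column of an
  -- edge is in place when the edge acts. The default `0` for both ends gives a chord that crosses
  -- nothing.
  lo t := if h : ∃ p, B.EdgeAt t p then B.y h.choose.1 else 0
  hi t := if h : ∃ p, B.EdgeAt t p then B.y h.choose.2 else 0
  jump t := {ρ | ∃ v, B.y v = ρ ∧ (t : ℤ) = 2 * B.l v}

variable {B}

lemma EdgeAt.eq (hB : B.IsNormal) {t : ℕ} {p q : V × V} (hp : B.EdgeAt t p) (hq : B.EdgeAt t q) :
    p = q :=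
  Prod.ext_iff.2 (hB.inj _ _ _ _ (by linarith [hp.2, hq.2]))

lemma EdgeAt.lo (hB : B.IsNormal) {t : ℕ} {p : V × V} (hp : B.EdgeAt t p) :
    B.sweep.lo t = B.y p.1 := by
  have h : ∃ p, B.EdgeAt t p := ⟨p, hp⟩
  simp only [sweep, dif_pos h, h.choose_spec.eq hB hp]

lemma EdgeAt.hi (hB : B.IsNormal) {t : ℕ} {p : V × V} (hp : B.EdgeAt t p) :
    B.sweep.hi t = B.y p.2 := by
  have h : ∃ p, B.EdgeAt t p := ⟨p, hp⟩
  simp only [sweep, dif_pos h, h.choose_spec.eq hB hp]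

lemma exists_edgeAt {t : ℕ} (h : B.sweep.lo t < B.sweep.hi t) : ∃ p, B.EdgeAt t p := by
  by_contra hp
  simp [sweep, hp] at h

lemma cross_iff (hB : B.IsNormal) {t : ℕ} {p : V × V} (hp : B.EdgeAt t p) (ρ : ℤ) :
    B.sweep.Cross t ρ ↔ B.y p.1 < ρ ∧ ρ < B.y p.2 := by
  rw [Sweep.Cross, hp.lo hB, hp.hi hB]

lemma finite_touch [Finite V] (hB : B.IsNormal) :
    {c : ℕ × ℤ | B.sweep.Touch c.1 c.2}.Finite := by
  refine Set.Finite.subset (s := (⋃ p : V × V, {(2 * B.col p.1 p.2 + 1).toNat} ×ˢ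
    Set.Ioo (B.y p.1) (B.y p.2)) ∪ Set.range fun v => ((2 * B.l v).toNat, B.y v)) ?_ ?_
  · exact (Set.finite_iUnion fun p => (Set.finite_singleton _).prod (Set.finite_Ioo _ _)).union
      (Set.finite_range _)
  · rintro ⟨t, ρ⟩ (h | ⟨v, h1, h2⟩)
    · obtain ⟨p, hp⟩ := exists_edgeAt h.lt
      refine Or.inl (Set.mem_iUnion.2 ⟨p, ?_, (cross_iff hB hp ρ).1 h⟩)
      have := hp.2
      simp only [Set.mem_singleton_iff]; omega
    · simp only at h1 h2
      refine Or.inr ⟨v, ?_⟩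
      simp only [Prod.mk.injEq]
      exact ⟨by omega, h1⟩

/-- Two different edges with the same end rows differ in one of their end bars; the later of these
bars starts between the two edges, and its start is a jump of the row. -/
lemma sweep_simple (hB : B.IsNormal) (i k : ℕ) (hik : i < k) (hlo : B.sweep.lo i = B.sweep.lo k)
    (hhi : B.sweep.hi i = B.sweep.hi k) (hc : ∃ ρ, B.sweep.Cross i ρ) :
    ∃ j, i ≤ j ∧ j < k ∧ (B.sweep.Touch j (B.sweep.lo i) ∨ B.sweep.Touch j (B.sweep.hi i)) := by
  obtain ⟨ρ, hρ⟩ := hc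
  obtain ⟨p, hp⟩ := exists_edgeAt hρ.lt
  obtain ⟨q, hq⟩ := exists_edgeAt (hlo ▸ hhi ▸ hρ.lt)
  have key : ∀ u u' : V, u ≠ u' → B.y u = B.y u' → B.l u ≤ B.col p.1 p.2 →
      B.col p.1 p.2 ≤ B.r u → B.l u' ≤ B.col q.1 q.2 → B.col q.1 q.2 ≤ B.r u' →
      ∃ j, i ≤ j ∧ j < k ∧ B.sweep.Touch j (B.y u) := by
    intro u u' hne hy h1 h2 h3 h4
    have h5 := hp.2
    have h6 := hq.2
    have h7 := hB.nonneg u'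
    have h8 : B.r u < B.l u' := by
      rcases B.disjoint u u' hne with h | h | h | h <;> omega
    exact ⟨(2 * B.l u').toNat, by omega, by omega, Or.inr ⟨u', hy.symm, by omega⟩⟩
  have e1 := hp.lo hB
  have e2 := hp.hi hB
  have e3 := hq.lo hB
  have e4 := hq.hi hB
  by_cases h1 : p.1 = q.1
  · by_cases h2 : p.2 = q.2
    · have := hp.2
      have := hq.2
      rw [h1, h2] at *
      omega
    · obtain ⟨j, h3, h4, h5⟩ := key _ _ h2 (by omega) hp.1.2.2.1.1 hp.1.2.2.1.2 hq.1.2.2.1.1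
        hq.1.2.2.1.2
      exact ⟨j, h3, h4, Or.inr (e2 ▸ h5)⟩
  · obtain ⟨j, h3, h4, h5⟩ := key _ _ h1 (by omega) hp.1.2.1.1 hp.1.2.1.2 hq.1.2.1.1 hq.1.2.1.2
    exact ⟨j, h3, h4, Or.inl (e1 ▸ h5)⟩

lemma not_touch (hB : B.IsNormal) {v : V} {t : ℕ} (h1 : 2 * B.l v + 1 ≤ t)
    (h2 : (t : ℤ) ≤ 2 * B.r v + 1) : ¬ B.sweep.Touch t (B.y v) := by
  rintro (h | ⟨w, h3, h4⟩)
  · obtain ⟨p, hp⟩ := exists_edgeAt h.lt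
    rw [cross_iff hB hp] at h
    have := hp.2
    rcases hp.1.2.2.2 v with h5 | h5 | h5 | h5 <;> omega
  · have := B.le w
    by_cases hwv : w = v
    · subst hwv; omega
    · rcases B.disjoint w v hwv with h5 | h5 | h5 | h5 <;> omega

variable (B) in
/-- Horizontal coordinates that are consistent with the bar representation. -/
structure Coord (x : V → ℤ) : Prop where
  row : ∀ u v, B.y u = B.y v → B.r u < B.l v → x u < x v
  left : ∀ u v w, B.Up u v → B.y u < B.y w → B.y w < B.y v → B.r w < B.col u v →
    x w * (B.y v - B.y u) < x u * (B.y v - B.y w) + x v * (B.y w - B.y u)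
  right : ∀ u v w, B.Up u v → B.y u < B.y w → B.y w < B.y v → B.col u v < B.l w →
    x u * (B.y v - B.y w) + x v * (B.y w - B.y u) < x w * (B.y v - B.y u)

lemma exists_int_multiples [Finite V] (x : V → ℚ) :
    ∃ N : ℤ, 0 < N ∧ ∃ z : V → ℤ, ∀ v, (z v : ℚ) = x v * N := by
  classical
  have := Fintype.ofFinite V
  refine ⟨∏ v, ((x v).den : ℤ), Finset.prod_pos fun v _ => by exact_mod_cast (x v).pos, ?_⟩
  have : ∀ v, ∃ z : ℤ, (z : ℚ) = x v * (∏ v, ((x v).den : ℤ) : ℤ) := by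
    intro v
    obtain ⟨c, hc⟩ := Finset.dvd_prod_of_mem (fun v => ((x v).den : ℤ)) (Finset.mem_univ v)
    refine ⟨(x v).num * c, ?_⟩
    rw [hc]
    push_cast
    rw [← mul_assoc, Rat.mul_den_eq_num]
  choose z hz using this
  exact ⟨z, hz⟩

theorem exists_coord [Finite V] (hB : B.IsNormal) : ∃ x, B.Coord x := by
  obtain ⟨X, hstill, hjump, hcross⟩ := Sweep.exists_front (finite_touch hB) (sweep_simple hB)
  have hmono : ∀ ρ, Monotone fun t => X t ρ := fun ρ => monotone_nat_of_le_succ fun t => by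
    by_cases h : B.sweep.Touch t ρ
    · exact (hjump t ρ h).le
    · exact (hstill t ρ h).ge
  -- A vertex is placed where its row stands just after its bar starts; the row then rests as long
  -- as the bar lasts.
  set x : V → ℚ := fun v => X (2 * B.l v + 1).toNat (B.y v) with hx
  have hbar : ∀ v (t : ℕ), 2 * B.l v + 1 ≤ t → (t : ℤ) ≤ 2 * B.r v + 2 → X t (B.y v) = x v := by
    intro v t h1
    have h0 := hB.nonneg v
    have h1' : (2 * B.l v + 1).toNat ≤ t := by omega
    clear h1
    induction t, h1' using Nat.le_induction with
    | base => intro _; rfl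
    | succ t ht ih =>
      intro h2
      rw [← ih (by omega)]
      exact hstill t _ (not_touch hB (by omega) (by omega))
  have hchord : ∀ u v, B.Up u v → ∀ t : ℕ, (t : ℤ) = 2 * B.col u v + 1 → ∀ ρ,
      B.sweep.chord (X t) t ρ = (x u * (B.y v - ρ) + x v * (ρ - B.y u)) / (B.y v - B.y u) := by
    intro u v h t ht ρ
    have he : B.EdgeAt t (u, v) := ⟨h, ht⟩
    obtain ⟨-, ⟨h1, h2⟩, ⟨h3, h4⟩, -⟩ := h
    rw [Sweep.chord, he.lo hB, he.hi hB, hbar u t (by omega) (by omega),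
      hbar v t (by omega) (by omega)]
  have row : ∀ u v, B.y u = B.y v → B.r u < B.l v → x u < x v := by
    intro u v hy h
    have h1 := B.le u
    have h2 := hB.nonneg u
    have h3 := hB.nonneg v
    rw [← hbar u (2 * B.r u + 2).toNat (by omega) (by omega),
      ← hbar v ((2 * B.l v).toNat + 1) (by omega) (by have := B.le v; omega), hy]
    exact (hmono (B.y v) (by omega)).trans_lt
      (hjump (2 * B.l v).toNat _ (Or.inr ⟨v, rfl, by omega⟩))
  have pos : ∀ u v, B.y u < B.y v → (0 : ℚ) < B.y v - B.y u := fun u v h => by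
    have : (B.y u : ℚ) < B.y v := by exact_mod_cast h
    linarith
  have left : ∀ u v w, B.Up u v → B.y u < B.y w → B.y w < B.y v → B.r w < B.col u v →
      x w * (B.y v - B.y u) < x u * (B.y v - B.y w) + x v * (B.y w - B.y u) := by
    intro u v w h h1 h2 h3
    have h4 := hB.nonneg w
    have h5 := B.le w
    obtain ⟨t, ht⟩ := Int.eq_ofNat_of_zero_le (show 0 ≤ 2 * B.col u v + 1 by omega)
    have h6 := (hcross t (B.y w) ((cross_iff hB (p := (u, v)) ⟨h, ht.symm⟩ _).2 ⟨h1, h2⟩)).1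
    rw [hchord u v h t ht.symm, lt_div_iff₀ (pos u v h.1)] at h6
    refine lt_of_le_of_lt (mul_le_mul_of_nonneg_right ?_ (pos u v h.1).le) h6
    rw [← hbar w (2 * B.r w + 2).toNat (by omega) (by omega)]
    exact hmono _ (by omega)
  have right : ∀ u v w, B.Up u v → B.y u < B.y w → B.y w < B.y v → B.col u v < B.l w →
      x u * (B.y v - B.y w) + x v * (B.y w - B.y u) < x w * (B.y v - B.y u) := by
    intro u v w h h1 h2 h3
    have h4 := hB.nonneg u
    have h5 := h.2.1.1
    obtain ⟨t, ht⟩ := Int.eq_ofNat_of_zero_le (show 0 ≤ 2 * B.col u v + 1 by omega)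
    have h6 := (hcross t (B.y w) ((cross_iff hB (p := (u, v)) ⟨h, ht.symm⟩ _).2 ⟨h1, h2⟩)).2
    rw [hchord u v h t ht.symm, div_lt_iff₀ (pos u v h.1)] at h6
    refine h6.trans_le (mul_le_mul_of_nonneg_right ?_ (pos u v h.1).le)
    exact hmono _ (by omega)
  -- The conditions of `Coord` are homogeneous in `x`, so denominators can be cleared.
  obtain ⟨N, hN, z, hz⟩ := exists_int_multiples x
  have hN' : (0 : ℚ) < N := by exact_mod_cast hN
  refine ⟨z, fun u v hy h => ?_, fun u v w h h1 h2 h3 => ?_, fun u v w h h1 h2 h3 => ?_⟩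
  · have := mul_lt_mul_of_pos_right (row u v hy h) hN'
    rw [← hz, ← hz] at this
    exact_mod_cast this
  · have := mul_lt_mul_of_pos_right (left u v w h h1 h2 h3) hN'
    have e : ∀ v, x v * N = z v := fun v => (hz v).symm
    have : ((z w * (B.y v - B.y u) : ℤ) : ℚ) <
        (z u * (B.y v - B.y w) + z v * (B.y w - B.y u) : ℤ) := by
      push_cast
      rw [← e, ← e, ← e]; linarith
    exact_mod_cast this
  · have := mul_lt_mul_of_pos_right (right u v w h h1 h2 h3) hN'
    have e : ∀ v, x v * N = z v := fun v => (hz v).symm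
    have : ((z u * (B.y v - B.y w) + z v * (B.y w - B.y u) : ℤ) : ℚ) <
        (z w * (B.y v - B.y u) : ℤ) := by
      push_cast
      rw [← e, ← e, ← e]; linarith
    exact_mod_cast this

end BarRep

/-! ### Consistent coordinates give a planar straight-line drawing. -/

lemma mem_segment_rows {a b c d : ℝ} {p : ℝ × ℝ} (h : p ∈ segment ℝ (a, b) (c, d)) (hbd : b < d) :
    b ≤ p.2 ∧ p.2 ≤ d ∧ p.1 * (d - b) = a * (d - p.2) + c * (p.2 - b) := by
  obtain ⟨s, t, hs, ht, hst, rfl⟩ := h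
  obtain rfl : s = 1 - t := by linarith
  simp only [Prod.smul_mk, Prod.mk_add_mk, smul_eq_mul]
  refine ⟨?_, ?_, ?_⟩
  · nlinarith
  · nlinarith
  · ring

lemma mem_segment_row {a b c d : ℝ} {p : ℝ × ℝ} (h : p ∈ segment ℝ (a, b) (c, d)) (hbd : b = d)
    (hac : a ≤ c) : p.2 = b ∧ a ≤ p.1 ∧ p.1 ≤ c := by
  obtain ⟨s, t, hs, ht, hst, rfl⟩ := h
  obtain rfl : s = 1 - t := by linarith
  subst hbd
  simp only [Prod.smul_mk, Prod.mk_add_mk, smul_eq_mul]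
  refine ⟨?_, ?_, ?_⟩
  · ring
  · nlinarith
  · nlinarith

namespace BarRep

variable {V : Type*} {G : SimpleGraph V} {B : BarRep G} {x : V → ℤ}

lemma lt_of_cols {u u' : V} (hne : u ≠ u') (hy : B.y u = B.y u') {c c' : ℤ} (hc : c < c')
    (h1 : B.l u ≤ c) (h4 : c' ≤ B.r u') : B.r u < B.l u' := by
  rcases B.disjoint u u' hne with h | h | h | h <;> omega

namespace Coord

lemma row_cases (hx : B.Coord x) {u v : V} (hne : u ≠ v) (hy : B.y u = B.y v) :
    (B.r u < B.l v ∧ x u < x v) ∨ (B.r v < B.l u ∧ x v < x u) := by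
  rcases B.disjoint u v hne with h | h | h | h
  · omega
  · omega
  · exact Or.inl ⟨h, hx.row _ _ hy h⟩
  · exact Or.inr ⟨h, hx.row _ _ hy.symm h⟩

lemma flat_lt (hx : B.Coord x) {u v : V} (h : B.Flat u v) : x u < x v :=
  hx.row u v h.1 (by rw [h.2]; omega)

lemma flat_end (hx : B.Coord x) {u v w : V} (h : B.Flat u v) (hw : B.y w = B.y u)
    (h1 : x u ≤ x w) (h2 : x w ≤ x v) : w = u ∨ w = v := by
  by_contra! hne
  have := h.2
  have := B.le w
  rcases hx.row_cases hne.1 hw with h3 | h3 <;>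
  rcases hx.row_cases hne.2 (hw.trans h.1) with h4 | h4 <;> omega

lemma up_notMem (hx : B.Coord x) {u v w : V} (h : B.Up u v) (hu : w ≠ u) (hv : w ≠ v) :
    ((x w : ℝ), (B.y w : ℝ)) ∉ segment ℝ ((x u : ℝ), (B.y u : ℝ)) ((x v : ℝ), (B.y v : ℝ)) := by
  intro hm
  obtain ⟨h1, h2, h3⟩ := mem_segment_rows hm (by exact_mod_cast h.1)
  simp only at h1 h2 h3
  have h1 : B.y u ≤ B.y w := by exact_mod_cast h1
  have h2 : B.y w ≤ B.y v := by exact_mod_cast h2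
  have h3 : x w * (B.y v - B.y u) = x u * (B.y v - B.y w) + x v * (B.y w - B.y u) := by
    exact_mod_cast h3
  have h0 := h.1
  rcases h1.eq_or_lt with h1 | h1
  · have : x w = x u := by
      rw [← h1] at h3
      exact mul_right_cancel₀ (sub_ne_zero.2 h0.ne') (h3.trans (by ring))
    rcases hx.row_cases hu h1.symm with h | h <;> omega
  rcases h2.eq_or_lt with h2 | h2
  · have : x w = x v := by
      rw [h2] at h3
      exact mul_right_cancel₀ (sub_ne_zero.2 h0.ne') (h3.trans (by ring))
    rcases hx.row_cases hv h2 with h | h <;> omega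
  · rcases h.2.2.2 w with h4 | h4 | h4 | h4
    · omega
    · omega
    · exact (hx.left u v w h h1 h2 h4).ne h3
    · exact (hx.right u v w h h1 h2 h4).ne' h3

lemma flat_notMem (hx : B.Coord x) {u v w : V} (h : B.Flat u v) (hu : w ≠ u) (hv : w ≠ v) :
    ((x w : ℝ), (B.y w : ℝ)) ∉ segment ℝ ((x u : ℝ), (B.y u : ℝ)) ((x v : ℝ), (B.y v : ℝ)) := by
  intro hm
  obtain ⟨h1, h2, h3⟩ := mem_segment_row hm (by exact_mod_cast h.1)
    (by exact_mod_cast (hx.flat_lt h).le)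
  simp only at h1 h2 h3
  rcases hx.flat_end h (by exact_mod_cast h1) (by exact_mod_cast h2) (by exact_mod_cast h3) with
    h | h
  · exact hu h
  · exact hv h

/-- The common points of two segments that are allowed in a drawing. -/
def SharedEnd (B : BarRep G) (x : V → ℤ) (u v u' v' : V) (p : ℝ × ℝ) : Prop :=
  ∃ w : V, (w = u ∨ w = v) ∧ (w = u' ∨ w = v') ∧ p = ((x w : ℝ), (B.y w : ℝ))

lemma SharedEnd.symm {u v u' v' : V} {p : ℝ × ℝ} (h : SharedEnd B x u v u' v' p) :
    SharedEnd B x u' v' u v p := by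
  obtain ⟨w, h1, h2, h3⟩ := h
  exact ⟨w, h2, h1, h3⟩

/-- The segment from `u` to `v` at height `η`. -/
noncomputable def line (B : BarRep G) (x : V → ℤ) (u v : V) (η : ℝ) : ℝ :=
  (x u * (B.y v - η) + x v * (η - B.y u)) / (B.y v - B.y u)

lemma line_affine (u v : V) (c η d : ℝ) :
    line B x u v η * (d - c) = line B x u v c * (d - η) + line B x u v d * (η - c) := by
  unfold line; ring

lemma line_end {u v w : V} (h : B.y u < B.y v) (hw : w = u ∨ w = v) :
    line B x u v (B.y w) = x w := by
  have : (B.y v : ℝ) - B.y u ≠ 0 := by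
    have : (B.y u : ℝ) < B.y v := by exact_mod_cast h
    linarith
  rcases hw with rfl | rfl <;> unfold line <;> field_simp <;> ring

/-- In the row of an end of either edge, the order of the columns is the order of the edges: if both
edges end there, their bars are ordered, and if one passes, it avoids the bar of the other's end. -/
lemma line_lt_line (hx : B.Coord x) {u v u' v' a : V} (h : B.Up u v) (h' : B.Up u' v')
    (hcol : B.col u v < B.col u' v') (ha : a = u ∨ a = v ∨ a = u' ∨ a = v')
    (h1 : B.y u ≤ B.y a) (h2 : B.y a ≤ B.y v) (h3 : B.y u' ≤ B.y a) (h4 : B.y a ≤ B.y v') :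
    line B x u v (B.y a) < line B x u' v' (B.y a) ∨
      (a = u ∨ a = v) ∧ (a = u' ∨ a = v') := by
  have hy : (0 : ℝ) < B.y v - B.y u := by
    have : (B.y u : ℝ) < B.y v := by exact_mod_cast h.1
    linarith
  have hy' : (0 : ℝ) < B.y v' - B.y u' := by
    have : (B.y u' : ℝ) < B.y v' := by exact_mod_cast h'.1
    linarith
  have bars : ∀ b, b = u ∨ b = v → B.l b ≤ B.col u v ∧ B.col u v ≤ B.r b := by
    rintro b (rfl | rfl)
    · exact h.2.1
    · exact h.2.2.1
  have bars' : ∀ b, b = u' ∨ b = v' → B.l b ≤ B.col u' v' ∧ B.col u' v' ≤ B.r b := by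
    rintro b (rfl | rfl)
    · exact h'.2.1
    · exact h'.2.2.1
  have both : ∀ b b', (b = u ∨ b = v) → (b' = u' ∨ b' = v') → B.y b = B.y b' → b ≠ b' →
      line B x u v (B.y b) < line B x u' v' (B.y b) := by
    intro b b' hb hb' hyb hne
    rw [line_end h.1 hb, hyb, line_end h'.1 hb']
    exact_mod_cast hx.row b b' hyb (lt_of_cols hne hyb hcol (bars b hb).1 (bars' b' hb').2)
  by_cases ha1 : a = u ∨ a = v
  · by_cases ha2 : a = u' ∨ a = v'
    · exact Or.inr ⟨ha1, ha2⟩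
    left
    rcases h3.eq_or_lt with h5 | h5
    · exact both a u' ha1 (Or.inl rfl) h5.symm fun e => ha2 (Or.inl e)
    rcases h4.eq_or_lt with h6 | h6
    · exact both a v' ha1 (Or.inr rfl) h6 fun e => ha2 (Or.inr e)
    rw [line_end h.1 ha1, line, lt_div_iff₀ hy']
    have hb := bars a ha1
    rcases h'.2.2.2 a with h7 | h7 | h7 | h7
    · omega
    · omega
    · exact_mod_cast hx.left u' v' a h' h5 h6 h7
    · omega
  · have ha2 : a = u' ∨ a = v' := by tauto
    left
    rcases h1.eq_or_lt with h5 | h5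
    · have := both u a (Or.inl rfl) ha2 h5 fun e => ha1 (Or.inl e.symm)
      rwa [h5] at this
    rcases h2.eq_or_lt with h6 | h6
    · have := both v a (Or.inr rfl) ha2 h6.symm fun e => ha1 (Or.inr e.symm)
      rwa [← h6] at this
    rw [line_end h'.1 ha2, line, div_lt_iff₀ hy]
    have hb := bars' a ha2
    rcases h.2.2.2 a with h7 | h7 | h7 | h7
    · omega
    · omega
    · omega
    · exact_mod_cast hx.right u v a h h5 h6 h7

lemma mem_line {u v : V} {p : ℝ × ℝ} (h : B.y u < B.y v)
    (hp : p ∈ segment ℝ ((x u : ℝ), (B.y u : ℝ)) ((x v : ℝ), (B.y v : ℝ))) :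
    B.y u ≤ p.2 ∧ p.2 ≤ B.y v ∧ p.1 = line B x u v p.2 := by
  have h' : (B.y u : ℝ) < B.y v := by exact_mod_cast h
  obtain ⟨h1, h2, h3⟩ := mem_segment_rows hp h'
  refine ⟨h1, h2, ?_⟩
  rw [line, eq_div_iff (by linarith), h3]

/-- The common range of heights is bounded by the rows of two ends `a` and `b`. At each of them the
edges are strictly ordered or share the end, and both edges are affine in between, so they can meet
only at a shared end. -/
lemma up_up (hx : B.Coord x) {u v u' v' : V} (h : B.Up u v) (h' : B.Up u' v')
    (hcol : B.col u v < B.col u' v') (hne : ¬ (u = u' ∧ v = v')) {p : ℝ × ℝ}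
    (hp : p ∈ segment ℝ ((x u : ℝ), (B.y u : ℝ)) ((x v : ℝ), (B.y v : ℝ)))
    (hp' : p ∈ segment ℝ ((x u' : ℝ), (B.y u' : ℝ)) ((x v' : ℝ), (B.y v' : ℝ))) :
    SharedEnd B x u v u' v' p := by
  obtain ⟨h1, h2, h3⟩ := mem_line h.1 hp
  obtain ⟨h1', h2', h3'⟩ := mem_line h'.1 hp'
  have hy := h.1
  have hy' := h'.1
  obtain ⟨a, ha, ha1, ha2, ha3⟩ : ∃ a, (a = u ∨ a = v ∨ a = u' ∨ a = v') ∧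
      B.y u ≤ B.y a ∧ B.y u' ≤ B.y a ∧ (B.y a : ℝ) ≤ p.2 := by
    rcases le_total (B.y u) (B.y u') with h | h
    · exact ⟨u', by tauto, h, le_rfl, h1'⟩
    · exact ⟨u, by tauto, le_rfl, h, h1⟩
  obtain ⟨b, hb, hb1, hb2, hb3⟩ : ∃ b, (b = u ∨ b = v ∨ b = u' ∨ b = v') ∧
      B.y b ≤ B.y v ∧ B.y b ≤ B.y v' ∧ p.2 ≤ B.y b := by
    rcases le_total (B.y v) (B.y v') with h | h
    · exact ⟨v, by tauto, le_rfl, h, h2⟩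
    · exact ⟨v', by tauto, h, le_rfl, h2'⟩
  have hab : B.y a ≤ B.y b := by exact_mod_cast ha3.trans hb3
  have done : ∀ w, (w = u ∨ w = v) ∧ (w = u' ∨ w = v') → p.2 = B.y w →
      SharedEnd B x u v u' v' p := fun w hw e =>
    ⟨w, hw.1, hw.2, Prod.ext (by rw [h3, e, line_end hy hw.1]) e⟩
  have e1 := line_affine (B := B) (x := x) u v (B.y a) p.2 (B.y b)
  have e2 := line_affine (B := B) (x := x) u' v' (B.y a) p.2 (B.y b)
  rw [← h3] at e1
  rw [← h3'] at e2
  rcases hx.line_lt_line h h' hcol ha ha1 (hab.trans hb1) ha2 (hab.trans hb2) with hA | hA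
  · rcases hx.line_lt_line h h' hcol hb (ha1.trans hab) hb1 (ha2.trans hab) hb2 with hB | hB
    · exfalso
      rcases ha3.eq_or_lt with h4 | h4
      · rw [h4, ← h3, ← h3'] at hA
        exact lt_irrefl _ hA
      · nlinarith [mul_pos (sub_pos.2 hB) (sub_pos.2 h4),
          mul_nonneg (sub_pos.2 hA).le (sub_nonneg.2 hb3)]
    · refine done b hB (le_antisymm hb3 ?_)
      by_contra! h4
      rw [line_end hy hB.1] at e1
      rw [line_end hy' hB.2] at e2
      nlinarith [mul_pos (sub_pos.2 hA) (sub_pos.2 h4)]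
  · rcases hx.line_lt_line h h' hcol hb (ha1.trans hab) hb1 (ha2.trans hab) hb2 with hB | hB
    · refine done a hA (le_antisymm ?_ ha3)
      by_contra! h4
      rw [line_end hy hA.1] at e1
      rw [line_end hy' hA.2] at e2
      nlinarith [mul_pos (sub_pos.2 hB) (sub_pos.2 h4)]
    -- Shared ends in two different rows would make the edges equal.
    · rcases hab.eq_or_lt with h4 | h4
      · exact done a hA (le_antisymm (h4 ▸ hb3) ha3)
      · exfalso
        have hau : a = u := hA.1.resolve_right fun e => by subst e; omega
        have hau' : a = u' := hA.2.resolve_right fun e => by subst e; omega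
        have hbv : b = v := hB.1.resolve_left fun e => by subst e; omega
        have hbv' : b = v' := hB.2.resolve_left fun e => by subst e; omega
        exact hne ⟨hau.symm.trans hau', hbv.symm.trans hbv'⟩

/-- The bars of a horizontal edge leave no column between them, so a vertical edge passing their row
has both on the same side. -/
lemma up_flat (hx : B.Coord x) {u v u' v' : V} (h : B.Up u v) (h' : B.Flat u' v') {p : ℝ × ℝ}
    (hp : p ∈ segment ℝ ((x u : ℝ), (B.y u : ℝ)) ((x v : ℝ), (B.y v : ℝ)))
    (hp' : p ∈ segment ℝ ((x u' : ℝ), (B.y u' : ℝ)) ((x v' : ℝ), (B.y v' : ℝ))) :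
    SharedEnd B x u v u' v' p := by
  obtain ⟨h1, h2, h3⟩ := mem_line h.1 hp
  obtain ⟨h4, h5, h6⟩ := mem_segment_row hp' (by exact_mod_cast h'.1)
    (by exact_mod_cast (hx.flat_lt h').le)
  rw [h4] at h1 h2 h3
  have h1 : B.y u ≤ B.y u' := by exact_mod_cast h1
  have h2 : B.y u' ≤ B.y v := by exact_mod_cast h2
  have done : ∀ w, (w = u ∨ w = v) → B.y w = B.y u' → SharedEnd B x u v u' v' p := by
    intro w hw e
    have hpw : p.1 = x w := by rw [h3, ← e, line_end h.1 hw]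
    rw [hpw] at h5 h6
    exact ⟨w, hw, hx.flat_end h' e (by exact_mod_cast h5) (by exact_mod_cast h6),
      Prod.ext hpw (by rw [h4, e])⟩
  rcases h1.eq_or_lt with h1 | h1
  · exact done u (Or.inl rfl) h1
  rcases h2.eq_or_lt with h2 | h2
  · exact done v (Or.inr rfl) h2.symm
  exfalso
  have hy : (0 : ℝ) < B.y v - B.y u := by
    have : (B.y u : ℝ) < B.y v := by exact_mod_cast h.1
    linarith
  have e := h'.1
  have e' := h'.2
  rw [line, eq_div_iff hy.ne'] at h3
  rcases h.2.2.2 u' with h7 | h7 | h7 | h7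
  · omega
  · omega
  · have h8 : B.r v' < B.col u v := by
      rcases h.2.2.2 v' with h8 | h8 | h8 | h8
      · omega
      · omega
      · exact h8
      · omega
    have h9 : (x v' : ℝ) * (B.y v - B.y u) < x u * (B.y v - B.y v') + x v * (B.y v' - B.y u) := by
      exact_mod_cast hx.left u v v' h (by omega) (by omega) h8
    rw [← e, ← h3] at h9
    exact absurd (lt_of_mul_lt_mul_right h9 hy.le) h6.not_gt
  · have h9 : (x u : ℝ) * (B.y v - B.y u') + x v * (B.y u' - B.y u) < x u' * (B.y v - B.y u) := by
      exact_mod_cast hx.right u v u' h h1 h2 h7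
    rw [← h3] at h9
    exact absurd (lt_of_mul_lt_mul_right h9 hy.le) h5.not_gt

lemma flat_flat (hx : B.Coord x) {u v u' v' : V} (h : B.Flat u v) (h' : B.Flat u' v')
    (hne : ¬ (u = u' ∧ v = v')) {p : ℝ × ℝ}
    (hp : p ∈ segment ℝ ((x u : ℝ), (B.y u : ℝ)) ((x v : ℝ), (B.y v : ℝ)))
    (hp' : p ∈ segment ℝ ((x u' : ℝ), (B.y u' : ℝ)) ((x v' : ℝ), (B.y v' : ℝ))) :
    SharedEnd B x u v u' v' p := by
  obtain ⟨h1, h2, h3⟩ := mem_segment_row hp (by exact_mod_cast h.1)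
    (by exact_mod_cast (hx.flat_lt h).le)
  obtain ⟨h4, h5, h6⟩ := mem_segment_row hp' (by exact_mod_cast h'.1)
    (by exact_mod_cast (hx.flat_lt h').le)
  have hy : B.y u = B.y u' := by rw [h1] at h4; exact_mod_cast h4
  have o1 : x u ≤ x v' := by exact_mod_cast h2.trans h6
  have o2 : x u' ≤ x v := by exact_mod_cast h5.trans h3
  have hv := h.2
  have hv' := h'.2
  have l1 := B.le u
  have l2 := B.le u'
  have l3 := B.le v
  have l4 := B.le v'
  have y1 := h.1
  have y2 := h'.1
  by_cases huu : u = u'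
  · subst huu
    have : v ≠ v' := fun e => hne ⟨rfl, e⟩
    rcases hx.row_cases this (by omega) with h7 | h7 <;> omega
  · rcases hx.row_cases huu hy with h7 | h7
    · by_cases hvu : v = u'
      · subst hvu
        refine ⟨v, Or.inr rfl, Or.inl rfl, Prod.ext (le_antisymm h3 h5) ?_⟩
        rw [h1, h.1]
      · rcases hx.row_cases hvu (by omega) with h8 | h8 <;> omega
    · by_cases hvu : v' = u
      · subst hvu
        refine ⟨v', Or.inl rfl, Or.inr rfl, Prod.ext (le_antisymm h6 h2) ?_⟩
        rw [h1]
      · rcases hx.row_cases hvu (by omega) with h8 | h8 <;> omega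

lemma meet (hB : B.IsNormal) (hx : B.Coord x) {u v u' v' : V} (h : B.Up u v ∨ B.Flat u v)
    (h' : B.Up u' v' ∨ B.Flat u' v') (hne : ¬ (u = u' ∧ v = v')) {p : ℝ × ℝ}
    (hp : p ∈ segment ℝ ((x u : ℝ), (B.y u : ℝ)) ((x v : ℝ), (B.y v : ℝ)))
    (hp' : p ∈ segment ℝ ((x u' : ℝ), (B.y u' : ℝ)) ((x v' : ℝ), (B.y v' : ℝ))) :
    SharedEnd B x u v u' v' p := by
  rcases h with h | h <;> rcases h' with h' | h'
  · rcases lt_trichotomy (B.col u v) (B.col u' v') with hc | hc | hc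
    · exact hx.up_up h h' hc hne hp hp'
    · exact absurd (hB.inj _ _ _ _ hc) hne
    · exact (hx.up_up h' h hc (fun e => hne ⟨e.1.symm, e.2.symm⟩) hp' hp).symm
  · exact hx.up_flat h h' hp hp'
  · exact (hx.up_flat h' h hp' hp).symm
  · exact hx.flat_flat h h' hne hp hp'

/-- The straight-line drawing with the rows of the bar representation. -/
def drawing (hB : B.IsNormal) (hx : B.Coord x) : PlanarStraightLineDrawing G where
  x := x
  y := B.y
  vertex_disjoint u v huv h := by
    rw [Prod.mk.injEq] at h
    rcases hx.row_cases huv h.2 with h' | h' <;> omega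
  vertex_edge_disjoint u v w h hu hv := by
    rcases B.edge' h with h | h | h | h
    · exact hx.up_notMem h hu hv
    · rw [segment_symm]; exact hx.up_notMem h hv hu
    · exact hx.flat_notMem h hu hv
    · rw [segment_symm]; exact hx.flat_notMem h hv hu
  edge_edge_disjoint u v u' v' h h' hne p hp hp' := by
    have orient : ∀ {u v}, G.Adj u v →
        (B.Up u v ∨ B.Flat u v) ∨ (B.Up v u ∨ B.Flat v u) := fun h => by
      have := B.edge' h; tauto
    have swap : ∀ {a b c d}, SharedEnd B x a b c d p → SharedEnd B x b a c d p := by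
      rintro a b c d ⟨w, h1, h2, h3⟩
      exact ⟨w, h1.symm, h2, h3⟩
    rw [Ne, Sym2.eq_iff, not_or] at hne
    rcases orient h with h | h <;> rcases orient h' with h' | h'
    · exact meet hB hx h h' hne.1 hp hp'
    · rw [segment_symm] at hp'
      exact (swap (meet hB hx h h' hne.2 hp hp').symm).symm
    · rw [segment_symm] at hp
      exact swap (meet hB hx h h' (fun e => hne.2 ⟨e.2, e.1⟩) hp hp')
    · rw [segment_symm] at hp hp'
      exact swap (swap (meet hB hx h h' (fun e => hne.1 ⟨e.2, e.1⟩) hp hp').symm).symm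

end Coord

theorem exists_drawing [Finite V] (B : BarRep G) {h : ℕ} (hy : ∀ v, 1 ≤ B.y v ∧ B.y v ≤ h) :
    ∃ D : PlanarStraightLineDrawing G, D.height ≤ h := by
  obtain ⟨B', hB', hn⟩ := B.exists_isNormal
  obtain ⟨x, hx⟩ := exists_coord hn
  refine ⟨hx.drawing hn, Nat.sInf_le ?_⟩
  obtain ⟨a, ha⟩ := (Set.finite_range x).bddBelow
  obtain ⟨b, hb⟩ := (Set.finite_range x).bddAbove
  refine ⟨(b - a + 1).toNat, 1 - a, 0, fun v => ?_⟩
  have h1 : a ≤ x v := ha ⟨v, rfl⟩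
  have h2 : x v ≤ b := hb ⟨v, rfl⟩
  have h3 := hy v
  rw [← hB'] at h3
  have e1 : (hx.drawing hn).x v = x v := rfl
  have e2 : (hx.drawing hn).y v = B'.y v := rfl
  rw [e1, e2]
  omega

end BarRep

/-! ### From a drawing to a bar representation. -/

namespace PlanarStraightLineDrawing

variable {V : Type*} {G : SimpleGraph V} (D : PlanarStraightLineDrawing G)

/-- Vertices, as pairs `(v, v)`, and nonhorizontal edges, oriented upwards. -/
def IsObj (p : V × V) : Prop := p.1 = p.2 ∨ G.Adj p.1 p.2 ∧ D.y p.1 < D.y p.2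

/-- The point of the object `p` at height `η`. -/
noncomputable def xAt (p : V × V) (η : ℝ) : ℝ :=
  D.x p.1 + (D.x p.2 - D.x p.1) * ((η - D.y p.1) / (D.y p.2 - D.y p.1))

/-- The range of heights of an object. -/
def Spans (p : V × V) (η : ℝ) : Prop := D.y p.1 ≤ η ∧ η ≤ D.y p.2

def IsEnd (w : V) (p : V × V) : Prop := w = p.1 ∨ w = p.2

/-- On some common height, `p` lies strictly left of `q`. -/
def LeftOf (p q : V × V) : Prop :=
  ∃ η, D.Spans p η ∧ D.Spans q η ∧ D.xAt p η < D.xAt q η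

variable {D}

lemma IsObj.y_le {p : V × V} (hp : D.IsObj p) : D.y p.1 ≤ D.y p.2 := by
  rcases hp with h | h
  · rw [h]
  · exact h.2.le

lemma xAt_add (p : V × V) (η η' c : ℝ) :
    D.xAt p (η + c * (η' - η)) = D.xAt p η + c * (D.xAt p η' - D.xAt p η) := by
  unfold xAt; ring

lemma xAt_end {p : V × V} (hp : D.IsObj p) {w : V} (hw : IsEnd w p) : D.xAt p (D.y w) = D.x w := by
  rcases hp with h | ⟨-, h⟩
  · have : w = p.1 := by rcases hw with e | e <;> simp [e, h]
    subst this
    simp [xAt, h]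
  · have : (D.y p.2 : ℝ) - D.y p.1 ≠ 0 := by
      have : (D.y p.1 : ℝ) < D.y p.2 := by exact_mod_cast h
      linarith
    rcases hw with rfl | rfl
    · simp [xAt]
    · rw [xAt, div_self this]; ring

lemma spans_end {p : V × V} (hp : D.IsObj p) {w : V} (hw : IsEnd w p) : D.Spans p (D.y w) := by
  have : (D.y p.1 : ℝ) ≤ D.y p.2 := by exact_mod_cast hp.y_le
  rcases hw with rfl | rfl
  · exact ⟨le_rfl, this⟩
  · exact ⟨this, le_rfl⟩

lemma xAt_mem_segment {p : V × V} (hp : D.y p.1 < D.y p.2) {η : ℝ} (hη : D.Spans p η) :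
    (D.xAt p η, η) ∈ segment ℝ ((D.x p.1 : ℝ), (D.y p.1 : ℝ)) ((D.x p.2 : ℝ), (D.y p.2 : ℝ)) := by
  have h : (0 : ℝ) < D.y p.2 - D.y p.1 := by
    have : (D.y p.1 : ℝ) < D.y p.2 := by exact_mod_cast hp
    linarith
  obtain ⟨h1, h2⟩ := hη
  rw [segment_eq_image']
  refine ⟨(η - D.y p.1) / (D.y p.2 - D.y p.1), ⟨div_nonneg (by linarith) h.le,
    (div_le_one h).2 (by linarith)⟩, ?_⟩
  ext
  · simp [xAt]; ring
  · simp [div_mul_cancel₀ _ h.ne']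

/-- Two objects only meet in a common end. -/
lemma exists_common_end {p q : V × V} (hp : D.IsObj p) (hq : D.IsObj q) (hne : p ≠ q) {η : ℝ}
    (h1 : D.Spans p η) (h2 : D.Spans q η) (h : D.xAt p η = D.xAt q η) :
    ∃ w, IsEnd w p ∧ IsEnd w q ∧ η = D.y w := by
  have point : ∀ p q : V × V, D.IsObj q → p.1 = p.2 → D.Spans p η → D.Spans q η →
      D.xAt p η = D.xAt q η → ∃ w, IsEnd w p ∧ IsEnd w q ∧ η = D.y w := by
    rintro ⟨u, u'⟩ q hq he h1 h2 h
    obtain rfl : u = u' := he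
    have hη : η = D.y u := le_antisymm h1.2 h1.1
    subst hη
    refine ⟨u, Or.inl rfl, ?_, rfl⟩
    rw [xAt_end (Or.inl rfl) (Or.inl rfl)] at h
    by_contra hu
    rw [IsEnd, not_or] at hu
    rcases hq with hq | hq
    · have hη : (D.y u : ℝ) = D.y q.1 := le_antisymm (hq ▸ h2.2) h2.1
      rw [hη, xAt_end (Or.inl hq) (Or.inl rfl)] at h
      exact D.vertex_disjoint u q.1 hu.1 (Prod.ext (by exact_mod_cast h) (by exact_mod_cast hη))
    · have := xAt_mem_segment hq.2 h2
      rw [← h] at this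
      exact D.vertex_edge_disjoint _ _ _ hq.1 hu.1 hu.2 this
  have hp0 := hp
  rcases hp with hp' | hp'
  · exact point p q hq hp' h1 h2 h
  rcases hq with hq' | hq'
  · obtain ⟨w, e1, e2, e3⟩ := point q p hp0 hq' h2 h1 h.symm
    exact ⟨w, e2, e1, e3⟩
  have hs : s(p.1, p.2) ≠ s(q.1, q.2) := by
    rw [Ne, Sym2.eq_iff, not_or]
    refine ⟨fun e => hne (Prod.ext e.1 e.2), fun e => ?_⟩
    have h3 := hp'.2
    have h4 := hq'.2
    rw [e.1, e.2] at h3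
    omega
  obtain ⟨w, e1, e2, e3⟩ := D.edge_edge_disjoint _ _ _ _ hp'.1 hq'.1 hs _
    (xAt_mem_segment hp'.2 h1) (h ▸ xAt_mem_segment hq'.2 h2)
  exact ⟨w, e1, e2, (Prod.mk.inj e3).2⟩

/-- Objects that change sides meet, by affinity, at a height strictly inside both ranges, where
neither has an end. -/
lemma LeftOf.le {p q : V × V} (hp : D.IsObj p) (hq : D.IsObj q) (h : D.LeftOf p q) {η : ℝ}
    (h1 : D.Spans p η) (h2 : D.Spans q η) : D.xAt p η ≤ D.xAt q η := by
  obtain ⟨θ, h3, h4, hlt⟩ := h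
  by_contra! hcon
  set d : ℝ := D.xAt q θ - D.xAt p θ with hd
  set e : ℝ := D.xAt p η - D.xAt q η with he
  have hd0 : 0 < d := sub_pos.2 hlt
  have he0 : 0 < e := sub_pos.2 hcon
  -- The gap between the objects runs affinely from `d` to `-e`; this is the parameter of its zero.
  set c : ℝ := d / (d + e) with hc
  have hc0 : 0 < c := by positivity
  have hc1 : c < 1 := (div_lt_one (by positivity)).2 (by linarith)
  have hce : c * (d + e) = d := div_mul_cancel₀ _ (by positivity)
  have hne : θ ≠ η := fun h => by subst h; linarith
  have between : ∀ r : V × V, D.Spans r θ → D.Spans r η →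
      D.y r.1 < θ + c * (η - θ) ∧ θ + c * (η - θ) < D.y r.2 := by
    rintro r ⟨a1, a2⟩ ⟨a3, a4⟩
    rcases hne.lt_or_gt with h | h
    · constructor <;> nlinarith [mul_pos hc0 (sub_pos.2 h), mul_pos (sub_pos.2 hc1) (sub_pos.2 h)]
    · constructor <;> nlinarith [mul_pos hc0 (sub_pos.2 h), mul_pos (sub_pos.2 hc1) (sub_pos.2 h)]
  obtain ⟨b1, b2⟩ := between p h3 h1
  obtain ⟨b3, b4⟩ := between q h4 h2
  obtain ⟨w, e1, -, e2⟩ := exists_common_end hp hq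
    (fun h => by subst h; exact lt_irrefl _ hlt) ⟨b1.le, b2.le⟩ ⟨b3.le, b4.le⟩ (by
      rw [xAt_add, xAt_add]; linarith)
  rcases e1 with rfl | rfl
  · exact b1.ne e2.symm
  · exact b2.ne e2

/-- Induction by adding an object `a` with the lowest top. If `b` is left of `a` and `a` is left of
`c`, all three span the higher of the two witnessing heights, so `b` is left of `c`. The values
forced below `ξ a` are thus smaller than those forced above it, which leaves room for `ξ a`. -/
lemma exists_potential (s : Finset (V × V)) :
    (∀ p ∈ s, D.IsObj p) → ∃ ξ : V × V → ℝ, ∀ p ∈ s, ∀ q ∈ s, D.LeftOf p q → ξ p < ξ q := by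
  classical
  induction s using Finset.induction_on_min_value (fun p : V × V => D.y p.2) with
  | empty => exact fun _ => ⟨0, by simp⟩
  | insert a s has hmin ih =>
    intro hobj
    have ha := hobj a (Finset.mem_insert_self a s)
    have hs : ∀ p ∈ s, D.IsObj p := fun p hp => hobj p (Finset.mem_insert_of_mem hp)
    obtain ⟨ξ, hξ⟩ := ih hs
    have irrefl : ¬ D.LeftOf a a := fun ⟨_, _, _, h⟩ => lt_irrefl _ h
    have trans : ∀ b ∈ s, ∀ c ∈ s, D.LeftOf b a → D.LeftOf a c → D.LeftOf b c := by
      intro b hb c hc hba hac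
      have hba' := hba
      have hac' := hac
      obtain ⟨η, h1, h2, h3⟩ := hba
      obtain ⟨θ, h4, h5, h6⟩ := hac
      have tb : (D.y a.2 : ℝ) ≤ D.y b.2 := by exact_mod_cast hmin b hb
      have tc : (D.y a.2 : ℝ) ≤ D.y c.2 := by exact_mod_cast hmin c hc
      rcases le_total η θ with h | h
      · have hbθ : D.Spans b θ := ⟨h1.1.trans h, h4.2.trans tb⟩
        exact ⟨θ, hbθ, h5, (hba'.le (hs b hb) ha hbθ h4).trans_lt h6⟩
      · have hcη : D.Spans c η := ⟨h5.1.trans h, h2.2.trans tc⟩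
        exact ⟨η, h1, hcη, h3.trans_le (hac'.le ha (hs c hc) h2 hcη)⟩
    obtain ⟨m, hlo, hhi⟩ := Order.exists_between_finsets
      ((s.filter fun b => D.LeftOf b a).image ξ) ((s.filter fun c => D.LeftOf a c).image ξ) (by
        simp only [Finset.mem_image, Finset.mem_filter]
        rintro _ ⟨b, ⟨hb, hba⟩, rfl⟩ _ ⟨c, ⟨hc, hac⟩, rfl⟩
        exact hξ b hb c hc (trans b hb c hc hba hac))
    refine ⟨Function.update ξ a m, fun p hp q hq hpq => ?_⟩
    have ne : ∀ p ∈ s, p ≠ a := fun p hp e => has (e ▸ hp)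
    rcases Finset.mem_insert.1 hp with rfl | hp' <;> rcases Finset.mem_insert.1 hq with rfl | hq'
    · exact absurd hpq irrefl
    · rw [Function.update_self, Function.update_of_ne (ne q hq')]
      exact hhi _ (Finset.mem_image_of_mem ξ (Finset.mem_filter.2 ⟨hq', hpq⟩))
    · rw [Function.update_self, Function.update_of_ne (ne p hp')]
      exact hlo _ (Finset.mem_image_of_mem ξ (Finset.mem_filter.2 ⟨hp', hpq⟩))
    · rw [Function.update_of_ne (ne p hp'), Function.update_of_ne (ne q hq')]
      exact hξ p hp' q hq' hpq

/-- Counting smaller values makes the potential integral and bounds it by `n ^ 2`, which later fixes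
the big-M constant. -/
lemma exists_rank [Fintype V] : ∃ ξ : V × V → ℤ, (∀ p, 0 ≤ ξ p ∧ ξ p ≤ (Fintype.card V : ℤ) ^ 2) ∧
    ∀ p q, D.IsObj p → D.IsObj q → D.LeftOf p q → ξ p < ξ q := by
  classical
  obtain ⟨ξ, hξ⟩ := exists_potential (D := D) (Finset.univ.filter fun p => D.IsObj p) (by simp)
  refine ⟨fun p => ((Finset.univ.filter fun q => ξ q < ξ p).card : ℤ), fun p => ⟨by positivity, ?_⟩,
    fun p q hp hq h => ?_⟩
  · have := Finset.card_le_univ (Finset.univ.filter fun q => ξ q < ξ p)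
    rw [Fintype.card_prod] at this
    rw [sq]
    beta_reduce
    exact_mod_cast this
  · have hlt := hξ p (by simpa using hp) q (by simpa using hq) h
    simp only [Nat.cast_lt]
    refine Finset.card_lt_card (Finset.ssubset_iff_of_subset ?_ |>.2 ⟨p, by simpa using hlt, by simp⟩)
    intro r hr
    simp only [Finset.mem_filter, Finset.mem_univ, true_and] at hr ⊢
    exact hr.trans hlt

lemma exists_fitsGrid [Finite V] : ∃ h w : ℕ, D.FitsGrid w h := by
  obtain ⟨a, ha⟩ := (Set.finite_range D.x).bddBelow
  obtain ⟨b, hb⟩ := (Set.finite_range D.x).bddAbove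
  obtain ⟨a', ha'⟩ := (Set.finite_range D.y).bddBelow
  obtain ⟨b', hb'⟩ := (Set.finite_range D.y).bddAbove
  refine ⟨(b' - a' + 1).toNat, (b - a + 1).toNat, 1 - a, 1 - a', fun v => ?_⟩
  have h1 : a ≤ D.x v := ha ⟨v, rfl⟩
  have h2 : D.x v ≤ b := hb ⟨v, rfl⟩
  have h3 : a' ≤ D.y v := ha' ⟨v, rfl⟩
  have h4 : D.y v ≤ b' := hb' ⟨v, rfl⟩
  omega

/-- The rows can be renumbered so that no row is empty. -/
lemma exists_rows [Fintype V] : ∃ Y : V → ℤ, (∀ u v, Y u < Y v ↔ D.y u < D.y v) ∧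
    ∀ v, 1 ≤ Y v ∧ Y v ≤ D.height ∧ Y v ≤ Fintype.card V := by
  classical
  set R : V → Finset ℤ := fun v => (Finset.univ.image D.y).filter (· ≤ D.y v) with hR
  have sub : ∀ u v, D.y u ≤ D.y v → R u ⊆ R v := fun u v h =>
    Finset.monotone_filter_right _ fun _ _ h' => le_trans h' h
  have lt : ∀ u v, D.y u < D.y v → (R u).card < (R v).card := fun u v h =>
    Finset.card_lt_card <| (Finset.ssubset_iff_of_subset (sub u v h.le)).2
      ⟨D.y v, by simp [hR], by simp [hR, h]⟩
  refine ⟨fun v => ((R v).card : ℤ), fun u v => ⟨fun h => ?_, fun h => by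
    simpa using lt u v h⟩, fun v => ⟨?_, ?_, ?_⟩⟩
  · by_contra! h'
    have := Finset.card_le_card (sub v u h')
    simp only [Nat.cast_lt] at h
    omega
  · have : 0 < (R v).card := Finset.card_pos.2 ⟨D.y v, by simp [hR]⟩
    beta_reduce
    omega
  · obtain ⟨w, s, t, hst⟩ : ∃ w : ℕ, D.FitsGrid w D.height :=
      Nat.sInf_mem (s := {h : ℕ | ∃ w : ℕ, D.FitsGrid w h}) exists_fitsGrid
    have h1 : R v ⊆ Finset.Icc (1 - t) (D.height - t) := by
      intro ρ hρ
      simp only [hR, Finset.mem_filter, Finset.mem_image, Finset.mem_univ, true_and] at hρ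
      obtain ⟨⟨u, rfl⟩, -⟩ := hρ
      have := (hst u).2
      rw [Finset.mem_Icc]; omega
    have h2 := Finset.card_le_card h1
    rw [Int.card_Icc] at h2
    beta_reduce
    omega
  · have h1 := Finset.card_le_card (Finset.filter_subset (· ≤ D.y v) (Finset.univ.image D.y))
    have h2 := Finset.card_image_le (s := (Finset.univ : Finset V)) (f := D.y)
    rw [Finset.card_univ] at h2
    simp only [hR]
    exact_mod_cast h1.trans h2

lemma mem_segment_of_row {a b c : ℝ} {η : ℝ} (h1 : a ≤ b) (h2 : b ≤ c) :
    (b, η) ∈ segment ℝ (a, η) (c, η) := by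
  rcases (h1.trans h2).eq_or_lt with h | h
  · obtain rfl : b = a := le_antisymm (h ▸ h2) h1
    exact left_mem_segment ℝ _ _
  · refine ⟨(c - b) / (c - a), (b - a) / (c - a), div_nonneg (by linarith) (by linarith),
      div_nonneg (by linarith) (by linarith), ?_, ?_⟩
    · have : c - a ≠ 0 := by linarith
      field_simp; ring
    · have : c - a ≠ 0 := by linarith
      ext
      · simp; field_simp; ring
      · simp; field_simp; ring

variable (D) in
/-- `v` and `w` are joined by a horizontal edge, and `w` is the right end. -/
def RightNbr (v w : V) : Prop := G.Adj v w ∧ D.y v = D.y w ∧ D.x v < D.x w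

lemma RightNbr.not_between {v w u : V} (h : D.RightNbr v w) (hu : D.y u = D.y v)
    (h1 : D.x v < D.x u) (h2 : D.x u < D.x w) : False := by
  obtain ⟨ha, hy, -⟩ := h
  refine D.vertex_edge_disjoint v w u ha (fun e => by subst e; omega) (fun e => by subst e; omega) ?_
  rw [← hy, hu]
  exact mem_segment_of_row (by exact_mod_cast h1.le) (by exact_mod_cast h2.le)

lemma eq_of_xy {u v : V} (hx : D.x u = D.x v) (hy : D.y u = D.y v) : u = v := by
  by_contra h
  exact D.vertex_disjoint u v h (Prod.ext hx hy)

theorem exists_barRep [Fintype V] (D : PlanarStraightLineDrawing G) :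
    ∃ B : BarRep G, (∀ v, 1 ≤ B.y v ∧ B.y v ≤ D.height ∧ B.y v ≤ Fintype.card V) ∧
      (∀ v, 0 ≤ B.l v ∧ B.r v ≤ (Fintype.card V : ℤ) ^ 2) ∧
      ∀ u v, 0 ≤ B.col u v ∧ B.col u v ≤ (Fintype.card V : ℤ) ^ 2 := by
  classical
  obtain ⟨ξ, hξ0, hξ⟩ := exists_rank (D := D)
  obtain ⟨Y, hY, hY'⟩ := exists_rows (D := D)
  have hYeq : ∀ u v, D.y u = D.y v → Y u = Y v := fun u v h => by
    have h1 := hY u v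
    have h2 := hY v u
    omega
  set inc : V → Finset (V × V) := fun v => Finset.univ.filter fun p => D.IsObj p ∧ IsEnd v p
    with hinc
  have hself : ∀ v, (inc v).Nonempty := fun v =>
    ⟨(v, v), Finset.mem_filter.2 ⟨Finset.mem_univ _, Or.inl rfl, Or.inl rfl⟩⟩
  have mem_inc : ∀ {v p}, p ∈ inc v ↔ D.IsObj p ∧ IsEnd v p := by simp [hinc]
  -- The bar must cover the columns of all nonhorizontal edges at `v`; the object `(v, v)` makes it
  -- nonempty.
  set l : V → ℤ := fun v => (inc v).inf' (hself v) ξ with hl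
  set R : V → ℤ := fun v => (inc v).sup' (hself v) ξ with hR
  have l_le : ∀ {v p}, D.IsObj p → IsEnd v p → l v ≤ ξ p := fun h1 h2 =>
    Finset.inf'_le _ (mem_inc.2 ⟨h1, h2⟩)
  have le_R : ∀ {v p}, D.IsObj p → IsEnd v p → ξ p ≤ R v := fun h1 h2 =>
    Finset.le_sup' _ (mem_inc.2 ⟨h1, h2⟩)
  have l_le_R : ∀ v, l v ≤ R v := fun v =>
    (l_le (p := (v, v)) (Or.inl rfl) (Or.inl rfl)).trans (le_R (Or.inl rfl) (Or.inl rfl))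
  have R_lt : ∀ {v q}, D.IsObj q → D.Spans q (D.y v) → D.x v < D.xAt q (D.y v) → R v < ξ q := by
    intro v q hq hs h
    obtain ⟨p, hp, e⟩ := Finset.exists_mem_eq_sup' (hself v) ξ
    obtain ⟨hp1, hp2⟩ := mem_inc.1 hp
    rw [hR]
    simp only [e]
    exact hξ p q hp1 hq ⟨D.y v, spans_end hp1 hp2, hs, by rwa [xAt_end hp1 hp2]⟩
  have lt_l : ∀ {v q}, D.IsObj q → D.Spans q (D.y v) → D.xAt q (D.y v) < D.x v → ξ q < l v := by
    intro v q hq hs h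
    obtain ⟨p, hp, e⟩ := Finset.exists_mem_eq_inf' (hself v) ξ
    obtain ⟨hp1, hp2⟩ := mem_inc.1 hp
    rw [hl]
    simp only [e]
    exact hξ q p hq hp1 ⟨D.y v, hs, spans_end hp1 hp2, by rwa [xAt_end hp1 hp2]⟩
  have R_lt_l : ∀ {u v}, D.y u = D.y v → D.x u < D.x v → R u < l v := by
    intro u v hy h
    obtain ⟨p, hp, e⟩ := Finset.exists_mem_eq_inf' (hself v) ξ
    obtain ⟨hp1, hp2⟩ := mem_inc.1 hp
    rw [hl]
    simp only [e]
    refine R_lt hp1 (hy ▸ spans_end hp1 hp2) ?_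
    rw [hy, xAt_end hp1 hp2]
    exact_mod_cast h
  -- A horizontal edge requires consecutive bars, so the bar is extended up to the bar of its right
  -- neighbour, which is unique because edges avoid other vertices.
  set r : V → ℤ := fun v => if h : ∃ w, D.RightNbr v w then l h.choose - 1 else R v with hr
  have r_cases : ∀ v, (∃ w, D.RightNbr v w ∧ r v = l w - 1) ∨
      ((∀ w, ¬ D.RightNbr v w) ∧ r v = R v) := by
    intro v
    by_cases h : ∃ w, D.RightNbr v w
    · exact Or.inl ⟨h.choose, h.choose_spec, by simp only [hr, dif_pos h]⟩
    · exact Or.inr ⟨not_exists.1 h, by simp only [hr, dif_neg h]⟩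
  have R_le_r : ∀ v, R v ≤ r v := by
    intro v
    rcases r_cases v with ⟨w, h1, h2⟩ | ⟨-, h2⟩
    · have := R_lt_l h1.2.1 h1.2.2
      omega
    · exact h2.ge
  have row : ∀ u v, D.y u = D.y v → D.x u < D.x v → r u < l v := by
    intro u v hy h
    rcases r_cases u with ⟨w, h1, h2⟩ | ⟨-, h2⟩
    · rcases lt_trichotomy (D.x v) (D.x w) with h3 | h3 | h3
      · exact (h1.not_between hy.symm h h3).elim
      · rw [eq_of_xy h3 (hy.symm.trans h1.2.1)]; omega
      · have h4 := R_lt_l (h1.2.1.symm.trans hy) h3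
        have h5 := l_le_R w
        omega
    · rw [h2]; exact R_lt_l hy h
  have up : ∀ u v, G.Adj u v → D.y u < D.y v → Y u < Y v ∧
      (l u ≤ ξ (u, v) ∧ ξ (u, v) ≤ r u) ∧ (l v ≤ ξ (u, v) ∧ ξ (u, v) ≤ r v) ∧
      ∀ w, Y w ≤ Y u ∨ Y v ≤ Y w ∨ r w < ξ (u, v) ∨ ξ (u, v) < l w := by
    intro u v h hy
    have ho : D.IsObj (u, v) := Or.inr ⟨h, hy⟩
    refine ⟨(hY u v).2 hy, ⟨l_le ho (Or.inl rfl), (le_R ho (Or.inl rfl)).trans (R_le_r u)⟩,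
      ⟨l_le ho (Or.inr rfl), (le_R ho (Or.inr rfl)).trans (R_le_r v)⟩, fun w => ?_⟩
    by_cases h1 : D.y u < D.y w
    swap
    · left; rw [← not_lt, hY]; exact h1
    by_cases h2 : D.y w < D.y v
    swap
    · right; left; rw [← not_lt, hY]; exact h2
    right; right
    have hs : ∀ w', D.y w' = D.y w → D.Spans (u, v) (D.y w') := fun w' e => by
      rw [e]
      exact ⟨by exact_mod_cast h1.le, by exact_mod_cast h2.le⟩
    have hmem := xAt_mem_segment (p := (u, v)) hy (hs w rfl)
    rcases lt_trichotomy (D.xAt (u, v) (D.y w)) (D.x w) with h3 | h3 | h3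
    · exact Or.inr (lt_l ho (hs w rfl) h3)
    · rw [h3] at hmem
      exact (D.vertex_edge_disjoint u v w h (fun e => by subst e; omega)
        (fun e => by subst e; omega) hmem).elim
    · left
      rcases r_cases w with ⟨z, h4, h5⟩ | ⟨-, h5⟩
      -- The edge cannot cross the horizontal edge from `w` to `z`, so `z` lies left of it too, and
      -- the extended bar of `w` stays left of its column.
      · have h6 : D.x z < D.xAt (u, v) (D.y w) := by
          by_contra! h6
          have hm : (D.xAt (u, v) (D.y w), (D.y w : ℝ)) ∈
              segment ℝ ((D.x w : ℝ), (D.y w : ℝ)) ((D.x z : ℝ), (D.y z : ℝ)) := by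
            rw [← h4.2.1]; exact mem_segment_of_row h3.le h6
          obtain ⟨a, e1, e2, -⟩ := D.edge_edge_disjoint u v w z h h4.1 (by
            rw [Ne, Sym2.eq_iff]
            rintro (⟨e, -⟩ | ⟨-, e⟩) <;> subst e <;> omega) _ hmem hm
          have hz := h4.2.1
          rcases e1 with rfl | rfl <;> rcases e2 with rfl | rfl <;> omega
        have hz := h4.2.1
        rw [hz] at h6
        have h7 := R_lt ho (hs z hz.symm) h6
        have h8 := l_le_R z
        omega
      · rw [h5]; exact R_lt ho (hs w rfl) h3
  have flat : ∀ u v, D.RightNbr u v → Y u = Y v ∧ l v = r u + 1 := by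
    intro u v h
    refine ⟨hYeq u v h.2.1, ?_⟩
    rcases r_cases u with ⟨w, h1, h2⟩ | ⟨h1, -⟩
    · have hvw : D.y v = D.y w := h.2.1.symm.trans h1.2.1
      rcases lt_trichotomy (D.x v) (D.x w) with h3 | h3 | h3
      · exact (h1.not_between h.2.1.symm h.2.2 h3).elim
      · rw [eq_of_xy h3 hvw, h2]; omega
      · exact (h.not_between h1.2.1.symm h1.2.2 h3).elim
    · exact absurd h (h1 v)
  refine ⟨⟨Y, l, r, fun u v => ξ (u, v), fun v => (l_le_R v).trans (R_le_r v), fun u v huv => ?_,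
    fun u v h => ?_⟩, hY', fun v => ⟨?_, ?_⟩, fun u v => hξ0 (u, v)⟩
  · rcases lt_trichotomy (D.y u) (D.y v) with h | h | h
    · exact Or.inl ((hY u v).2 h)
    · rcases lt_trichotomy (D.x u) (D.x v) with h' | h' | h'
      · exact Or.inr (Or.inr (Or.inl (row u v h h')))
      · exact absurd (eq_of_xy h' h) huv
      · exact Or.inr (Or.inr (Or.inr (row v u h.symm h')))
    · exact Or.inr (Or.inl ((hY v u).2 h))
  · rcases lt_trichotomy (D.y u) (D.y v) with h1 | h1 | h1
    · exact Or.inl (up u v h h1)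
    · rcases lt_trichotomy (D.x u) (D.x v) with h' | h' | h'
      · exact Or.inr (Or.inr (Or.inl (flat u v ⟨h, h1, h'⟩)))
      · exact absurd (eq_of_xy h' h1) h.ne
      · exact Or.inr (Or.inr (Or.inr (flat v u ⟨h.symm, h1.symm, h'⟩)))
    · exact Or.inr (Or.inl (up v u h.symm h1))
  · exact Finset.le_inf' (hself v) _ fun p _ => (hξ0 p).1
  · have hl' : ∀ v, l v ≤ (Fintype.card V : ℤ) ^ 2 := fun v =>
      (l_le (p := (v, v)) (Or.inl rfl) (Or.inl rfl)).trans (hξ0 _).2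
    rcases r_cases v with ⟨w, -, h⟩ | ⟨-, h⟩
    · simp only [h]; linarith [hl' w]
    · simp only [h]
      exact Finset.sup'_le (hself v) _ fun p _ => (hξ0 p).2

end PlanarStraightLineDrawing

/-! ### Systems of linear constraints as formulations. -/

/-- A linear constraint `∑ terms ≤ rhs - [adj is an edge]`. -/
structure LinCon (V κ : Type*) where
  terms : List (ℤ × κ)
  rhs : ℤ
  adj : Option (V × V)

namespace LinCon

variable {V κ : Type*}

open Classical in
/-- The assignment `z` satisfies the constraint for the graph `G`. -/
def Sat (c : LinCon V κ) (G : SimpleGraph V) (z : κ → ℤ) : Prop :=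
  (c.terms.map fun t => t.1 * z t.2).sum ≤
    c.rhs - c.adj.elim 0 fun p => if G.Adj p.1 p.2 then 1 else 0

/-- All coefficients have absolute value at most `M`. -/
def BoundedBy (c : LinCon V κ) (M : ℤ) : Prop :=
  (c.terms.map fun t => |t.1|).sum ≤ M ∧ |c.rhs| ≤ M

lemma sum_terms [Fintype κ] [DecidableEq κ] (T : List (ℤ × κ)) (z : κ → ℤ) :
    ∑ i, (T.map fun t => if t.2 = i then t.1 else 0).sum * z i =
      (T.map fun t => t.1 * z t.2).sum := by
  induction T with
  | nil => simp
  | cons t T ih => simp [add_mul, Finset.sum_add_distrib, ih]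

/-- A variable may occur in several terms of one constraint, for instance in `join u u`. Its matrix
entry is their sum, which is why `BoundedBy` bounds the sum of the absolute values. -/
lemma abs_coeff_le [DecidableEq κ] (T : List (ℤ × κ)) (i : κ) :
    |(T.map fun t => if t.2 = i then t.1 else 0).sum| ≤ (T.map fun t => |t.1|).sum := by
  induction T with
  | nil => simp
  | cons t T ih =>
    simp only [List.map_cons, List.sum_cons]
    refine (abs_add_le _ _).trans (add_le_add ?_ ih)
    split_ifs <;> simp

/-- A finite system of constraints is a formulation in the sense of the integer programs. -/
lemma exists_formulation {n : ℕ} {μ : Type*} [Fintype κ] [Fintype μ] (con : μ → LinCon (Fin n) κ)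
    (obj : κ) {M : ℤ} (hM : 1 ≤ M) (hcon : ∀ j, (con j).BoundedBy M) :
    ∃ F : GraphIPFormulation n (Fintype.card κ) (Fintype.card μ), F.CoeffsBoundedBy M ∧
      ∃ e : (Fin (Fintype.card κ) → ℤ) ≃ (κ → ℤ), ∀ G z,
        ((F.program G).IsFeasible z ↔ ∀ j, (con j).Sat G (e z)) ∧
        (F.program G).objective z = e z obj := by
  classical
  let f := Fintype.equivFin κ
  let g := Fintype.equivFin μ
  refine ⟨⟨fun j i => ((con (g.symm j)).terms.map fun t => if t.2 = f.symm i then t.1 else 0).sum,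
    fun j => (con (g.symm j)).rhs,
    fun j u v => if (con (g.symm j)).adj = some (u, v) then -1 else 0,
    fun i => if f.symm i = obj then 1 else 0⟩, ⟨fun j i => ?_, fun j => ?_, fun j u v => ?_,
    fun i => ?_⟩, Equiv.arrowCongr f.symm (Equiv.refl ℤ), fun G z => ⟨?_, ?_⟩⟩
  · exact (abs_coeff_le _ _).trans (hcon _).1
  · exact (hcon _).2
  · simp only; split_ifs <;> simp <;> omega
  · simp only; split_ifs <;> simp <;> omega
  · rw [← g.symm.forall_congr_right]
    refine forall_congr' fun j => ?_
    have h1 : ∑ i, ((con (g.symm j)).terms.map fun t =>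
        if t.2 = f.symm i then t.1 else 0).sum * z i =
        ((con (g.symm j)).terms.map fun t => t.1 * z (f t.2)).sum := by
      rw [← sum_terms _ fun i => z (f i), ← f.symm.sum_comp]
      simp
    have h2 : ∑ u, ∑ v, (if (con (g.symm j)).adj = some (u, v) then (-1 : ℤ) else 0) *
        (if G.Adj u v then 1 else 0) =
        -((con (g.symm j)).adj.elim 0 fun p => if G.Adj p.1 p.2 then 1 else 0) := by
      cases h : (con (g.symm j)).adj with
      | none => simp
      | some p =>
        rw [← Fintype.sum_prod_type' (f := fun u v =>
          (if some p = some (u, v) then (-1 : ℤ) else 0) * (if G.Adj u v then 1 else 0))]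
        simp only [Option.some.injEq, Prod.mk.eta]
        rw [Finset.sum_eq_single p]
        · by_cases hG : G.Adj p.1 p.2 <;> simp [hG]
        · intro b _ hb; simp [hb.symm]
        · intro h; exact absurd (Finset.mem_univ p) h
    simp only [GraphIPFormulation.program, Sat]
    rw [h1, sub_eq_add_neg, ← h2]
    rfl
  · simp only [IntegerProgram.objective, GraphIPFormulation.program, ite_mul, one_mul, zero_mul]
    rw [Finset.sum_eq_single (f obj)]
    · simp
    · intro b _ hb
      rw [if_neg]
      rintro rfl
      simp at hb
    · intro h; exact absurd (Finset.mem_univ _) h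

end LinCon

/-! ### The integer program of bar representations. -/

namespace BarProgram

open LinCon

/-- The variables of the program: the height; rows and bar ends; columns and case variables of
pairs; case variables of triples. -/
abbrev Var (V : Type*) :=
  Unit ⊕ (Fin 3 × V) ⊕ (Fin 5 × V × V) ⊕ (Fin 4 × V × V × V)

/-- The constraints of the program. -/
abbrev Idx (V : Type*) :=
  (Fin 3 × V) ⊕ (Fin 17 × V × V) ⊕ (Fin 9 × V × V × V)

variable {V : Type*}

abbrev height : Var V := .inl ()
abbrev y (v : V) : Var V := .inr (.inl (0, v))
abbrev l (v : V) : Var V := .inr (.inl (1, v))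
abbrev r (v : V) : Var V := .inr (.inl (2, v))
abbrev col (u v : V) : Var V := .inr (.inr (.inl (0, u, v)))
/-- The row of `u` is below the row of `v`. -/
abbrev below (u v : V) : Var V := .inr (.inr (.inl (1, u, v)))
/-- The bar of `u` ends before the bar of `v` starts. -/
abbrev before (u v : V) : Var V := .inr (.inr (.inl (2, u, v)))
/-- There is a vertical edge from `u` up to `v`. -/
abbrev up (u v : V) : Var V := .inr (.inr (.inl (3, u, v)))
/-- There is a horizontal edge from `u` right to `v`. -/
abbrev flat (u v : V) : Var V := .inr (.inr (.inl (4, u, v)))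
/-- The `i`-th reason why the vertical edge from `u` to `v` avoids the bar of `w`. -/
abbrev avoid (i : Fin 4) (u v w : V) : Var V := .inr (.inr (.inr (i, u, v, w)))

/-- The case variable `b` is at most `1`. -/
def bit (b : Var V) : LinCon V (Var V) := ⟨[(1, b)], 1, none⟩

/-- `s ≤ t`. -/
def le (s t : Var V) : LinCon V (Var V) := ⟨[(1, s), (-1, t)], 0, none⟩

/-- If `b = 1`, then `s + c ≤ t`. -/
def imp (M : ℤ) (b s t : Var V) (c : ℤ) : LinCon V (Var V) :=
  ⟨[(1, s), (-1, t), (M, b)], M - c, none⟩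

open Classical in
/-- Distinct vertices are in different rows or have disjoint bars. -/
noncomputable def separate (u v : V) : LinCon V (Var V) :=
  if u = v then ⟨[], 0, none⟩
  else ⟨[(-1, below u v), (-1, below v u), (-1, before u v), (-1, before v u)], -1, none⟩

/-- If `u` and `v` are adjacent, then some edge between them is drawn. -/
def join (u v : V) : LinCon V (Var V) :=
  ⟨[(-1, up u v), (-1, up v u), (-1, flat u v), (-1, flat v u)], 0, some (u, v)⟩

/-- If there is a vertical edge from `u` to `v`, then it avoids the bar of `w`. -/
def avoids (u v w : V) : LinCon V (Var V) :=
  ⟨[(1, up u v), (-1, avoid 0 u v w), (-1, avoid 1 u v w), (-1, avoid 2 u v w),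
    (-1, avoid 3 u v w)], 0, none⟩

noncomputable def con (M : ℤ) : Idx V → LinCon V (Var V) :=
  Sum.elim
    (fun p => ![⟨[(-1, y p.2)], -1, none⟩, le (y p.2) height, le (l p.2) (r p.2)] p.1) <|
  Sum.elim
    (fun p =>
      let u := p.2.1
      let v := p.2.2
      ![bit (below u v), bit (before u v), bit (up u v), bit (flat u v),
        separate u v, join u v,
        imp M (below u v) (y u) (y v) 1,
        imp M (before u v) (r u) (l v) 1,
        imp M (up u v) (y u) (y v) 1,
        imp M (up u v) (l u) (col u v) 0,
        imp M (up u v) (col u v) (r u) 0,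
        imp M (up u v) (l v) (col u v) 0,
        imp M (up u v) (col u v) (r v) 0,
        imp M (flat u v) (y u) (y v) 0,
        imp M (flat u v) (y v) (y u) 0,
        imp M (flat u v) (l v) (r u) (-1),
        imp M (flat u v) (r u) (l v) 1] p.1)
    (fun p =>
      let u := p.2.1
      let v := p.2.2.1
      let w := p.2.2.2
      ![bit (avoid 0 u v w), bit (avoid 1 u v w), bit (avoid 2 u v w), bit (avoid 3 u v w),
        avoids u v w,
        imp M (avoid 0 u v w) (y w) (y u) 0,
        imp M (avoid 1 u v w) (y v) (y w) 0,
        imp M (avoid 2 u v w) (r w) (col u v) 1,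
        imp M (avoid 3 u v w) (col u v) (l w) 1] p.1)

lemma forall_idx {P : Idx V → Prop} : (∀ j, P j) ↔
    (∀ v i, P (.inl (i, v))) ∧ (∀ u v i, P (.inr (.inl (i, u, v)))) ∧
      ∀ u v w i, P (.inr (.inr (i, u, v, w))) := by
  refine ⟨fun h => ⟨fun _ _ => h _, fun _ _ _ => h _, fun _ _ _ _ => h _⟩, ?_⟩
  rintro ⟨h1, h2, h3⟩ (⟨i, v⟩ | ⟨i, u, v⟩ | ⟨i, u, v, w⟩)
  · exact h1 _ _
  · exact h2 _ _ _
  · exact h3 _ _ _ _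

lemma boundedBy (M : ℤ) (hM : 1 ≤ M) (j : Idx V) : (con M j).BoundedBy (M + 5) := by
  have h0 : |M| = M := abs_of_nonneg (by omega)
  have h1 : |M - 1| = M - 1 := abs_of_nonneg (by omega)
  have h2 : |M + 1| = M + 1 := abs_of_nonneg (by omega)
  revert j
  rw [forall_idx]
  simp only [Fin.forall_fin_succ, IsEmpty.forall_iff, and_true]
  refine ⟨fun v => ?_, fun u v => ?_, fun u v w => ?_⟩
  · simp [con, BoundedBy, le]
    omega
  · by_cases huv : u = v <;>
    · simp [con, BoundedBy, bit, separate, join, imp, h0, h1, h2, huv]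
      omega
  · simp [con, BoundedBy, bit, avoids, imp, h0, h1]
    omega

variable {G : SimpleGraph V} {z : Var V → ℤ} {M : ℤ}

/-- The size of `M` matters only in this direction, for implications that are switched off;
`imp_of_sat` holds for every `M`. -/
lemma sat_imp_of {b s t : Var V} {c : ℤ} {P : Prop} [Decidable P] (hb : z b = if P then 1 else 0)
    (h : P → z s + c ≤ z t) (hM : z s - z t + c ≤ M) : (imp M b s t c).Sat G z := by
  simp only [Sat, imp, List.map_cons, List.map_nil, List.sum_cons, List.sum_nil, Option.elim, hb]
  split_ifs with hP
  · have := h hP; linarith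
  · linarith

lemma imp_of_sat {b s t : Var V} {c : ℤ} (h : (imp M b s t c).Sat G z) (hb : z b = 1) :
    z s + c ≤ z t := by
  simp only [Sat, imp, List.map_cons, List.map_nil, List.sum_cons, List.sum_nil, Option.elim,
    hb] at h
  linarith

/-- Every solution of the system is a bar representation with rows between `1` and the height. -/
lemma exists_barRep_of_sat (h : ∀ j, (con M j).Sat G z) :
    ∃ B : BarRep G, ∀ v, 1 ≤ B.y v ∧ B.y v ≤ z height := by
  rw [forall_idx] at h
  simp only [Fin.forall_fin_succ, IsEmpty.forall_iff, and_true] at h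
  simp [con] at h
  obtain ⟨hv, hp, ht⟩ := h
  have bits : ∀ {b : Var V}, (bit b).Sat G z → z b ≤ 1 := fun h => by
    simpa [Sat, bit] using h
  have les : ∀ {s t : Var V}, (le s t).Sat G z → z s ≤ z t := fun h => by
    simp [Sat, le] at h; omega
  have hup : ∀ u v, z (up u v) = 1 → z (y u) < z (y v) ∧
      (z (l u) ≤ z (col u v) ∧ z (col u v) ≤ z (r u)) ∧
      (z (l v) ≤ z (col u v) ∧ z (col u v) ≤ z (r v)) ∧
      ∀ w, z (y w) ≤ z (y u) ∨ z (y v) ≤ z (y w) ∨ z (r w) < z (col u v) ∨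
        z (col u v) < z (l w) := by
    intro u v h
    obtain ⟨-, -, -, -, -, -, -, -, h1, h2, h3, h4, h5, -⟩ := hp u v
    have h1 := imp_of_sat h1 h
    have h2 := imp_of_sat h2 h
    have h3 := imp_of_sat h3 h
    have h4 := imp_of_sat h4 h
    have h5 := imp_of_sat h5 h
    refine ⟨by omega, ⟨by omega, by omega⟩, ⟨by omega, by omega⟩, fun w => ?_⟩
    obtain ⟨b0, b1, b2, b3, hs, i0, i1, i2, i3⟩ := ht u v w
    have b0 := bits b0
    have b1 := bits b1
    have b2 := bits b2
    have b3 := bits b3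
    simp only [Sat, avoids, List.map_cons, List.map_nil, List.sum_cons, List.sum_nil, Option.elim,
      h] at hs
    -- Among integers that are at most `1` and have sum at least `1`, one equals `1`; so the case
    -- variables need no lower bound.
    have : z (avoid 0 u v w) = 1 ∨ z (avoid 1 u v w) = 1 ∨ z (avoid 2 u v w) = 1 ∨
        z (avoid 3 u v w) = 1 := by omega
    rcases this with h | h | h | h
    · have := imp_of_sat i0 h; omega
    · have := imp_of_sat i1 h; omega
    · have := imp_of_sat i2 h; omega
    · have := imp_of_sat i3 h; omega
  have hflat : ∀ u v, z (flat u v) = 1 → z (y u) = z (y v) ∧ z (l v) = z (r u) + 1 := by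
    intro u v h
    obtain ⟨-, -, -, -, -, -, -, -, -, -, -, -, -, h1, h2, h3, h4⟩ := hp u v
    have h1 := imp_of_sat h1 h
    have h2 := imp_of_sat h2 h
    have h3 := imp_of_sat h3 h
    have h4 := imp_of_sat h4 h
    omega
  have hbit : ∀ u v, z (below u v) ≤ 1 ∧ z (before u v) ≤ 1 ∧ z (up u v) ≤ 1 ∧
      z (flat u v) ≤ 1 := by
    intro u v
    obtain ⟨b0, b1, b2, b3, -⟩ := hp u v
    exact ⟨bits b0, bits b1, bits b2, bits b3⟩
  refine ⟨⟨fun v => z (y v), fun v => z (l v), fun v => z (r v), fun u v => z (col u v),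
    fun v => les (hv v).2.2, fun u v huv => ?_, fun u v huv => ?_⟩, fun v => ⟨?_, les (hv v).2.1⟩⟩
  · obtain ⟨-, -, -, -, hs, -, i1, i2, -⟩ := hp u v
    obtain ⟨-, -, -, -, -, -, i3, i4, -⟩ := hp v u
    obtain ⟨b1, b2, -, -⟩ := hbit u v
    obtain ⟨b3, b4, -, -⟩ := hbit v u
    rw [separate, if_neg huv] at hs
    simp only [Sat, List.map_cons, List.map_nil, List.sum_cons, List.sum_nil, Option.elim] at hs
    have : z (below u v) = 1 ∨ z (below v u) = 1 ∨ z (before u v) = 1 ∨ z (before v u) = 1 := by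
      omega
    rcases this with h | h | h | h
    · exact Or.inl (imp_of_sat i1 h)
    · exact Or.inr (Or.inl (imp_of_sat i3 h))
    · exact Or.inr (Or.inr (Or.inl (imp_of_sat i2 h)))
    · exact Or.inr (Or.inr (Or.inr (imp_of_sat i4 h)))
  · obtain ⟨-, -, -, -, -, hs, -⟩ := hp u v
    obtain ⟨-, -, b1, b2⟩ := hbit u v
    obtain ⟨-, -, b3, b4⟩ := hbit v u
    simp only [Sat, join, List.map_cons, List.map_nil, List.sum_cons, List.sum_nil, Option.elim,
      huv, if_true] at hs
    have : z (up u v) = 1 ∨ z (up v u) = 1 ∨ z (flat u v) = 1 ∨ z (flat v u) = 1 := by omega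
    rcases this with h | h | h | h
    · exact Or.inl (hup u v h)
    · exact Or.inr (Or.inl (hup v u h))
    · exact Or.inr (Or.inr (Or.inl (hflat u v h)))
    · exact Or.inr (Or.inr (Or.inr (hflat v u h)))
  · have := (hv v).1
    simp [Sat] at this
    omega

open Classical in
/-- The assignment that a bar representation gives. -/
noncomputable def assign (B : BarRep G) (h : ℤ) : Var V → ℤ :=
  Sum.elim (fun _ => h) <| Sum.elim (fun p => ![B.y p.2, B.l p.2, B.r p.2] p.1) <| Sum.elim
    (fun p =>
      let u := p.2.1
      let v := p.2.2
      ![B.col u v, if B.y u < B.y v then 1 else 0, if B.r u < B.l v then 1 else 0,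
        if B.Up u v then 1 else 0, if B.Flat u v then 1 else 0] p.1)
    (fun p =>
      let u := p.2.1
      let v := p.2.2.1
      let w := p.2.2.2
      ![if B.y w ≤ B.y u then 1 else 0, if B.y v ≤ B.y w then 1 else 0,
        if B.r w < B.col u v then 1 else 0, if B.col u v < B.l w then 1 else 0] p.1)

/-- All coordinates lie between `0` and `N` and all offsets are at most `1`, so `N + 1` is large
enough to make every switched-off implication vacuous. -/
lemma sat_assign (B : BarRep G) {h N : ℤ} (hy : ∀ v, 1 ≤ B.y v ∧ B.y v ≤ h ∧ B.y v ≤ N)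
    (hlr : ∀ v, 0 ≤ B.l v ∧ B.r v ≤ N) (hcol : ∀ u v, 0 ≤ B.col u v ∧ B.col u v ≤ N)
    (j : Idx V) : (con (N + 1) j).Sat G (assign B h) := by
  classical
  have zy : ∀ v, assign B h (y v) = B.y v := fun v => rfl
  have zl : ∀ v, assign B h (l v) = B.l v := fun v => rfl
  have zr : ∀ v, assign B h (r v) = B.r v := fun v => rfl
  have zh : assign B h height = h := rfl
  have zc : ∀ u v, assign B h (col u v) = B.col u v := fun u v => rfl
  have z1 : ∀ u v, assign B h (below u v) = if B.y u < B.y v then 1 else 0 := fun u v => by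
    simp [assign]
  have z2 : ∀ u v, assign B h (before u v) = if B.r u < B.l v then 1 else 0 := fun u v => by
    simp [assign]
  have z3 : ∀ u v, assign B h (up u v) = if B.Up u v then 1 else 0 := fun u v => by
    simp [assign]
  have z4 : ∀ u v, assign B h (flat u v) = if B.Flat u v then 1 else 0 := fun u v => by
    simp [assign]
  have a0 : ∀ u v w, assign B h (avoid 0 u v w) = if B.y w ≤ B.y u then 1 else 0 :=
    fun u v w => by simp [assign]
  have a1 : ∀ u v w, assign B h (avoid 1 u v w) = if B.y v ≤ B.y w then 1 else 0 :=
    fun u v w => by simp [assign]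
  have a2 : ∀ u v w, assign B h (avoid 2 u v w) = if B.r w < B.col u v then 1 else 0 :=
    fun u v w => by simp [assign]
  have a3 : ∀ u v w, assign B h (avoid 3 u v w) = if B.col u v < B.l w then 1 else 0 :=
    fun u v w => by simp [assign]
  have bits : ∀ {b : Var V} {P : Prop} [Decidable P], assign B h b = (if P then 1 else 0) →
      (bit b).Sat G (assign B h) := by
    intro b P _ hb
    simp only [Sat, bit, List.map_cons, List.map_nil, List.sum_cons, List.sum_nil, Option.elim, hb]
    split_ifs <;> norm_num
  have les : ∀ {s t : Var V}, assign B h s ≤ assign B h t → (le s t).Sat G (assign B h) := by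
    intro s t hst
    simp only [Sat, le, List.map_cons, List.map_nil, List.sum_cons, List.sum_nil, Option.elim]
    omega
  revert j
  rw [forall_idx]
  simp only [Fin.forall_fin_succ, IsEmpty.forall_iff, and_true]
  simp [con]
  refine ⟨fun v => ⟨?_, les (hy v).2.1, les (B.le v)⟩, fun u v => ?_, fun u v w => ?_⟩
  · have := (hy v).1
    simp only [Sat, List.map_cons, List.map_nil, List.sum_cons, List.sum_nil, Option.elim, zy]
    omega
  · have b1 := hy u
    have b2 := hy v
    have b3 := hlr u
    have b4 := hlr v
    have b5 := hcol u v
    have b6 := B.le u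
    have b7 := B.le v
    refine ⟨bits (z1 u v), bits (z2 u v), bits (z3 u v), bits (z4 u v), ?_, ?_,
      sat_imp_of (z1 u v) (fun h => ?_) ?_, sat_imp_of (z2 u v) (fun h => ?_) ?_,
      sat_imp_of (z3 u v) (fun h => ?_) ?_, sat_imp_of (z3 u v) (fun h => ?_) ?_,
      sat_imp_of (z3 u v) (fun h => ?_) ?_, sat_imp_of (z3 u v) (fun h => ?_) ?_,
      sat_imp_of (z3 u v) (fun h => ?_) ?_, sat_imp_of (z4 u v) (fun h => ?_) ?_,
      sat_imp_of (z4 u v) (fun h => ?_) ?_, sat_imp_of (z4 u v) (fun h => ?_) ?_,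
      sat_imp_of (z4 u v) (fun h => ?_) ?_⟩
    · by_cases huv : u = v
      · simp [separate, huv, Sat]
      · rw [separate, if_neg huv]
        simp only [Sat, List.map_cons, List.map_nil, List.sum_cons, List.sum_nil, Option.elim, z1,
          z2]
        have := B.disjoint u v huv
        split_ifs <;> omega
    · simp only [Sat, join, List.map_cons, List.map_nil, List.sum_cons, List.sum_nil, Option.elim,
        z3, z4]
      by_cases huv : G.Adj u v
      · rcases B.edge' huv with h | h | h | h <;> simp only [h, huv, if_true] <;>
          split_ifs <;> norm_num
      · simp only [huv, if_false]
        split_ifs <;> norm_num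
    all_goals simp only [zy, zl, zr, zc]
    all_goals first | omega | skip
    · have := h.1; omega
    · have := h.2.1.1; omega
    · have := h.2.1.2; omega
    · have := h.2.2.1.1; omega
    · have := h.2.2.1.2; omega
    · have := h.1; omega
    · have := h.1; omega
    · have := h.2; omega
    · have := h.2; omega
  · have b1 := hy u
    have b2 := hy v
    have b3 := hy w
    have b4 := hlr w
    have b5 := hcol u v
    have b6 := B.le w
    refine ⟨bits (a0 u v w), bits (a1 u v w), bits (a2 u v w), bits (a3 u v w), ?_,
      sat_imp_of (a0 u v w) (fun h => ?_) ?_, sat_imp_of (a1 u v w) (fun h => ?_) ?_,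
      sat_imp_of (a2 u v w) (fun h => ?_) ?_, sat_imp_of (a3 u v w) (fun h => ?_) ?_⟩
    · simp only [Sat, avoids, List.map_cons, List.map_nil, List.sum_cons, List.sum_nil,
        Option.elim, z3, a0, a1, a2, a3]
      by_cases huv : B.Up u v
      · have := huv.2.2.2 w
        rw [if_pos huv]
        split_ifs <;> omega
      · rw [if_neg huv]
        split_ifs <;> norm_num
    all_goals simp only [zy, zl, zr, zc]
    all_goals omega

end BarProgram

/-! ### Comparison of the optima and the main theorem. -/

/-- If drawings and solutions dominate each other in height, then the optima agree. -/
lemma isOptimalValue_iff {V : Type*} {G : SimpleGraph V} {k m : ℕ} {P : IntegerProgram k m}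
    (h1 : ∀ D : PlanarStraightLineDrawing G, ∃ z, P.IsFeasible z ∧ P.objective z ≤ D.height)
    (h2 : ∀ z, P.IsFeasible z → ∃ D : PlanarStraightLineDrawing G, (D.height : ℤ) ≤ P.objective z) :
    ((∃ z, P.IsFeasible z) ↔ Nonempty (PlanarStraightLineDrawing G)) ∧
      ∀ h : ℕ, P.IsOptimalValue (h : ℤ) ↔ IsMinStraightLineHeight G h := by
  refine ⟨⟨fun ⟨z, hz⟩ => ⟨(h2 z hz).choose⟩, fun ⟨D⟩ => ⟨_, (h1 D).choose_spec.1⟩⟩, fun h => ?_⟩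
  constructor
  · rintro ⟨⟨z, hz, hzh⟩, hmin⟩
    have low : ∀ D : PlanarStraightLineDrawing G, h ≤ D.height := fun D => by
      obtain ⟨z', hz', hle⟩ := h1 D
      have : (h : ℤ) ≤ P.objective z' := hmin ⟨z', hz', rfl⟩
      omega
    obtain ⟨D, hD⟩ := h2 z hz
    refine ⟨⟨D, le_antisymm ?_ (low D)⟩, ?_⟩
    · simp only; omega
    · rintro _ ⟨D', rfl⟩
      exact low D'
  · rintro ⟨⟨D, hDh⟩, hmin⟩
    have low : ∀ z, P.IsFeasible z → (h : ℤ) ≤ P.objective z := fun z hz => by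
      obtain ⟨D', hD'⟩ := h2 z hz
      have : h ≤ D'.height := hmin ⟨D', rfl⟩
      omega
    obtain ⟨z, hz, hle⟩ := h1 D
    refine ⟨⟨z, hz, le_antisymm ?_ (low z hz)⟩, ?_⟩
    · simp only at hDh; omega
    · rintro _ ⟨z', hz', rfl⟩
      exact low z' hz'

theorem mainTheorem11 :
    ∃ C d : ℕ, ∀ n : ℕ, ∃ k m : ℕ, k ≤ C * n ^ 3 ∧ m ≤ C * n ^ 3 ∧
      ∃ F : GraphIPFormulation n k m, F.CoeffsBoundedBy ((C : ℤ) * (n : ℤ) ^ d) ∧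
        ∀ G : SimpleGraph (Fin n),
          ((∃ z : Fin k → ℤ, (F.program G).IsFeasible z) ↔
            Nonempty (PlanarStraightLineDrawing G)) ∧
          ∀ h : ℕ, (F.program G).IsOptimalValue (h : ℤ) ↔ IsMinStraightLineHeight G h := by
  -- There are `1 + 3n + 5n² + 4n³ ≤ 13n³` variables and `3n + 17n² + 9n³ ≤ 29n³` constraints for `n
  -- ≥ 1`, and the entries are at most `n² + 6`.
  refine ⟨30, 2, fun n => ?_⟩
  -- For `n = 0` the bounds leave no room even for the height variable; the empty program has value
  -- `0`, as does the empty drawing.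
  rcases Nat.eq_zero_or_pos n with rfl | hn
  · refine ⟨0, 0, le_rfl, le_rfl, ⟨0, 0, 0, 0⟩, ⟨fun j => j.elim0, fun j => j.elim0,
      fun j => j.elim0, fun i => i.elim0⟩, fun G => isOptimalValue_iff (fun D => ⟨0, fun j => j.elim0,
      by simp [IntegerProgram.objective]⟩) fun z _ => ⟨⟨0, 0, fun v => v.elim0, fun v => v.elim0,
      fun v => v.elim0⟩, ?_⟩⟩
    have : PlanarStraightLineDrawing.height (G := G) ⟨0, 0, fun v => v.elim0, fun v => v.elim0,
        fun v => v.elim0⟩ = 0 :=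
      Nat.le_zero.1 (Nat.sInf_le ⟨0, 0, 0, fun v => v.elim0⟩)
    rw [this]
    simp [IntegerProgram.objective]
  have n1 : n ≤ n ^ 3 := Nat.le_self_pow (by norm_num) n
  have n2 : n ^ 2 ≤ n ^ 3 := Nat.pow_le_pow_right hn (by norm_num)
  have n3 : 1 ≤ n ^ 3 := Nat.one_le_pow _ _ hn
  have hM : (1 : ℤ) ≤ (n : ℤ) ^ 2 := one_le_pow₀ (by exact_mod_cast hn)
  have hnn : (n : ℤ) ≤ (n : ℤ) ^ 2 := by exact_mod_cast Nat.le_self_pow (by norm_num) n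
  obtain ⟨F, hF, e, he⟩ := LinCon.exists_formulation (n := n)
    (BarProgram.con ((n : ℤ) ^ 2 + 1)) BarProgram.height (M := 30 * (n : ℤ) ^ 2) (by linarith)
    fun j => by
      obtain ⟨h1, h2⟩ := BarProgram.boundedBy ((n : ℤ) ^ 2 + 1) (by linarith) j
      exact ⟨h1.trans (by linarith), h2.trans (by linarith)⟩
  refine ⟨_, _, ?_, ?_, F, by exact_mod_cast hF, fun G => isOptimalValue_iff (fun D => ?_)
    fun z hz => ?_⟩
  · simp only [Fintype.card_sum, Fintype.card_prod, Fintype.card_fin, Fintype.card_unit]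
    nlinarith
  · simp only [Fintype.card_sum, Fintype.card_prod, Fintype.card_fin]
    nlinarith
  · obtain ⟨B, hy, hlr, hcol⟩ := D.exists_barRep
    rw [Fintype.card_fin] at hy hlr hcol
    refine ⟨e.symm (BarProgram.assign B D.height), ?_, ?_⟩
    · rw [(he G _).1, e.apply_symm_apply]
      exact BarProgram.sat_assign B (fun v => ⟨(hy v).1, (hy v).2.1, (hy v).2.2.trans hnn⟩) hlr hcol
    · rw [(he G _).2, e.apply_symm_apply]
      exact le_rfl
  · rw [(he G _).1] at hz
    obtain ⟨B, hB⟩ := BarProgram.exists_barRep_of_sat hz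
    have h0 : 0 ≤ e z BarProgram.height := by
      have := hB ⟨0, hn⟩
      omega
    obtain ⟨h, hh⟩ := Int.eq_ofNat_of_zero_le h0
    obtain ⟨D, hD⟩ := B.exists_drawing (h := h) fun v => hh ▸ hB v
    refine ⟨D, ?_⟩
    rw [(he G _).2, hh]
    exact_mod_cast hD
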